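/- Let $\mathcal X,\mathcal Y$ be finite alphabets, $P_X$ a probability distribution on $\mathcal X$ and $P_{Y|X}$ a channel from $\mathcal X$ to $\mathcal Y$. Write $P_{XY}=P_XP_{Y|X}$ and $P_Y(y)=\sum_x P_X(x)P_{Y|X}(y|x)$, and assume that the channel is non-degenerate, i.e. $P_{Y|X}(\cdot|x)\neq P_Y$ for some $x$ with $P_X(x)>0$ (equivalently, $I(P_X,P_{Y|X})>0$). For $n\ge 1$ put $P_{X^n}(x^n)=\prod_{i=1}^n P_X(x_i)$, $P_{Y^n|X^n}(y^n|x^n)=\prod_{i=1}^n P_{Y|X}(y_i|x_i)$ and $P_{Y^n}(y^n)=\sum_{x^n}P_{X^n}(x^n)P_{Y^n|X^n}(y^n|x^n)$. Let $R>I(P_X,P_{Y|X})=\sum_{x,y}P_X(x)P_{Y|X}(y|x)\log\frac{P_{Y|X}(y|x)}{P_Y(y)}$ and $M=\lceil \exp(nR)\rceil$. Let $X_1^n,\dots,X_M^n$ be drawn independently from $P_{X^n}$, let $\mathscr C_M^n$ be the random codebook that they form, and let $$P_{Y^n|\mathscr C_M^n}(y^n)=\frac1M\sum_{j=1}^M P_{Y^n|X^n}(y^n|X_j^n)$$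 be the output distribution that it induces. With $\|P-Q\|_1=\sum_a|P(a)-Q(a)|$, the expectation $\mathbb E\,\|P_{Y^n|\mathscr C_M^n}-P_{Y^n}\|_1$ is positive for every $n\ge1$, and $$\lim_{n\to\infty}-\frac1n\log\mathbb E\left[\left\|P_{Y^n|\mathscr C_M^n}-P_{Y^n}\right\|_1\right] =\min_{Q_{XY}}\left\{D(Q_{XY}\|P_{XY})+\tfrac12\left[R-D(Q_{XY}\|P_XQ_Y)\right]_+\right\} =\max_{\lambda\in[1,2]}\left\{\frac{\lambda-1}{\lambda}\left(R-I^{\mathsf s}_\lambda(P_X,P_{Y|X})\right)\right\},$$ where the limit exists and is finite, and the minimum and the maximum are attained. Here the minimum is over all probability distributions $Q_{XY}$ on $\mathcal X\times\mathcal Y$, $Q_Y$ is the $\mathcal Y$-marginal of $Q_{XY}$, $[f]_+=\max\{0,f\}$, the relative entropy is $D(P\|Q)=\sum_a P(a)\log\frac{P(a)}{Q(a)}$ if $P\ll Q$ and $D(P\|Q)=+\infty$ otherwise, and $$I^{\mathsf s}_\lambda(P_X,P_{Y|X})=\frac{\lambda}{\lambda-1}\log\sum_{y\in\mathcal Y}\Bigl(\sum_{x\in\mathcal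 X}P_X(x)P_{Y|X}(y|x)^\lambda\Bigr)^{1/\lambda}\quad(\lambda\ne1),\qquad I^{\mathsf s}_1=I,$$ is Sibson's $\alpha$-mutual information of order $\lambda$. -/

import Mathlib

noncomputable section

namespace SoftCovering

/-- Relative entropy `D(p‖q)` of two probability mass functions on a finite alphabet, with values in
the extended reals: `∑ a, p a log (p a / q a)` (a term with `p a = 0` is zero) when `p ≪ q`, and `+∞`
otherwise. -/
def relEntropy {A : Type*} [Fintype A] (p q : A → ℝ) : EReal :=
  open Classical in
  if ∀ a, q a = 0 → p a = 0 then ((∑ a, p a * Real.log (p a / q a) : ℝ) : EReal) else ⊤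

/-- The `ℓ₁` distance (total variation distance without the factor `1/2`). -/
def l1Dist {A : Type*} [Fintype A] (p q : A → ℝ) : ℝ := ∑ a, |p a - q a|

/-- The joint distribution `P_X P_{Y|X}`; here `W x y` stands for `P_{Y|X}(y|x)`. -/
def jointDist {X Y : Type*} (P : X → ℝ) (W : X → Y → ℝ) : X × Y → ℝ :=
  fun z => P z.1 * W z.1 z.2

/-- The product distribution `P_X Q_Y`. -/
def prodDist {X Y : Type*} (P : X → ℝ) (Q : Y → ℝ) : X × Y → ℝ := fun z => P z.1 * Q z.2

/-- The second marginal `Q_Y` of a joint distribution `Q_{XY}`. -/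
def sndMarginal {X Y : Type*} [Fintype X] (Q : X × Y → ℝ) : Y → ℝ := fun y => ∑ x, Q (x, y)

/-- The output distribution of the channel `W` when the input has distribution `P`. -/
def outputDist {X Y : Type*} [Fintype X] (P : X → ℝ) (W : X → Y → ℝ) : Y → ℝ :=
  fun y => ∑ x, P x * W x y

/-- The i.i.d. extension `P_{X^n}`. -/
def iidExt {X : Type*} (P : X → ℝ) (n : ℕ) : (Fin n → X) → ℝ := fun x => ∏ i, P (x i)

/-- The stationary memoryless extension `P_{Y^n|X^n}` of a channel. -/
def memorylessExt {X Y : Type*} (W : X → Y → ℝ) (n : ℕ) : (Fin n → X) → (Fin n → Y) → ℝ :=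
  fun x y => ∏ i, W (x i) (y i)

/-- The output distribution induced by a codebook of `M` codewords of length `n`, when a uniformly
chosen codeword is sent through the memoryless channel. -/
def inducedDist {X Y : Type*} (W : X → Y → ℝ) {n M : ℕ} (c : Fin M → Fin n → X) :
    (Fin n → Y) → ℝ :=
  fun y => (1 / (M : ℝ)) * ∑ j, memorylessExt W n (c j) y

/-- The expectation `E ‖P_{Y^n|C} - P_{Y^n}‖₁`, where the `M` codewords of the codebook `C` are drawn
independently from `P_{X^n}`. -/
def expectedDist {X Y : Type*} [Fintype X] [Fintype Y] (P : X → ℝ) (W : X → Y → ℝ) (n M : ℕ) : ℝ :=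
  ∑ c : Fin M → Fin n → X, (∏ j, iidExt P n (c j)) *
    l1Dist (inducedDist W c) (outputDist (iidExt P n) (memorylessExt W n))

/-- The channel is non-degenerate for the input distribution `P`: input and output are not
independent, i.e. `P_{Y|X}(·|x) ≠ P_Y` for some input letter `x` of positive probability. -/
def Nondegenerate {X Y : Type*} [Fintype X] (P : X → ℝ) (W : X → Y → ℝ) : Prop :=
  ∃ x, P x ≠ 0 ∧ W x ≠ outputDist P W

/-- The mutual information `I(P_X, P_{Y|X})`, the expected information density. -/
def mutualInfo {X Y : Type*} [Fintype X] [Fintype Y] (P : X → ℝ) (W : X → Y → ℝ) : ℝ :=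
  ∑ x, ∑ y, P x * W x y * Real.log (W x y / outputDist P W y)

/-- Sibson's `α`-mutual information of order `l`; the order `1` is the mutual information. -/
def sibsonInfo {X Y : Type*} [Fintype X] [Fintype Y] (l : ℝ) (P : X → ℝ) (W : X → Y → ℝ) : ℝ :=
  open Classical in
  if l = 1 then mutualInfo P W
  else l / (l - 1) * Real.log (∑ y, (∑ x, P x * W x y ^ l) ^ (1 / l))

/-- The objective `D(Q_{XY}‖P_{XY}) + ½ [R - D(Q_{XY}‖P_X Q_Y)]₊`, an extended real. -/
def primalObjective {X Y : Type*} [Fintype X] [Fintype Y] (P : X → ℝ) (W : X → Y → ℝ) (R : ℝ)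
    (Q : X × Y → ℝ) : EReal :=
  relEntropy Q (jointDist P W) +
    ((1 / 2 : ℝ) : EReal) * max 0 ((R : EReal) - relEntropy Q (prodDist P (sndMarginal Q)))

/-- The objective `((l - 1) / l) (R - I_l(P_X, P_{Y|X}))`. -/
def dualObjective {X Y : Type*} [Fintype X] [Fintype Y] (P : X → ℝ) (W : X → Y → ℝ) (R : ℝ)
    (l : ℝ) : ℝ :=
  (l - 1) / l * (R - sibsonInfo l P W)

end SoftCovering

end

noncomputable section

namespace SoftCovering

/-! Write f(x^n) = P_{Y^n|X^n}(y^n|x^n) for a fixed output word y^n. The expected ℓ₁ distance is the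
sum over y^n of the mean absolute deviation of an average of M i.i.d. copies of f, so everything
rests on two estimates for such averages.

Upper bound (`iidMean_abs_average_le`): truncating f and using the variance below the level and the
mean above it bounds the deviation by 3 M^(1/l-1) (E f^l)^(1/l) for 1 ≤ l ≤ 2. Summed over y^n, the
l-th moments factor into the n-th power of Sibson's sum (`expectedDist_le`), so every l gives an
achievable exponent.

Lower bound (`le_iidMean_abs_average`): conditioning on whether each codeword lies in a set A
replaces f by a two-valued function, hence the average by a centred binomial variable, whose first
absolute moment is controlled by its second and fourth. For a joint law Q, take A to be the x^n
jointly Q-typical with y^n. There f differs from P_{Y^n}(y^n) by a factor 2 as soon as the Q-mean of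
the information density is nonzero; the typical set has total mass about exp(-n D(Q‖P_XY)) and each
section A has P_{X^n}-mass at most about exp(-n D(Q‖P_X Q_Y)). This yields the primal objective at Q
as a converse exponent. If that mean vanishes, Q is moved slightly towards P_XY, where it is I > 0.

Comparing the two bounds shows that each primal value is at least each dual value, without any
separate inequality between divergences. Equality comes from the tilted law `tiltedDist` at a
maximizer l of the dual: the derivative of the dual function is (R - D(Q‖P_X Q_Y))/l² at that law Q,
and the first-order conditions make the two objectives agree (`exists_dual_maximizer`). -/

lemma iidExt_nonneg {Ω : Type*} {μ : Ω → ℝ} (hμ : ∀ x, 0 ≤ μ x) (N : ℕ) (c : Fin N → Ω) : 0 ≤ iidExt μ N c :=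
  Finset.prod_nonneg fun _ _ => hμ _

/-! ### Moments of sums of i.i.d. variables. -/

section IidSums

variable {Ω : Type*} [Fintype Ω] {μ : Ω → ℝ}

/-- Expectation of `F` under the i.i.d. extension of `μ`. -/
def iidMean (μ : Ω → ℝ) (N : ℕ) (F : (Fin N → Ω) → ℝ) : ℝ := ∑ c, iidExt μ N c * F c

lemma iidMean_zero (F : (Fin 0 → Ω) → ℝ) : iidMean μ 0 F = F Fin.elim0 := by
  rw [iidMean, Fintype.sum_unique]
  simp only [iidExt, Finset.univ_eq_empty, Finset.prod_empty, one_mul]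
  congr 1

lemma iidMean_succ (N : ℕ) (F : (Fin (N + 1) → Ω) → ℝ) :
    iidMean μ (N + 1) F = ∑ x, μ x * iidMean μ N (fun c => F (Fin.cons x c)) := by
  simp only [iidMean, Finset.mul_sum]
  rw [← (Fin.consEquiv (fun _ : Fin (N + 1) => Ω)).sum_comp, Fintype.sum_prod_type]
  refine Finset.sum_congr rfl fun x _ => Finset.sum_congr rfl fun c _ => ?_
  simp [iidExt, Fin.consEquiv, Fin.prod_univ_succ, mul_assoc]

lemma iidMean_mono (hμ : ∀ x, 0 ≤ μ x) {N : ℕ} {F G : (Fin N → Ω) → ℝ} (h : ∀ c, F c ≤ G c) :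
    iidMean μ N F ≤ iidMean μ N G :=
  Finset.sum_le_sum fun c _ => mul_le_mul_of_nonneg_left (h c) (iidExt_nonneg hμ N c)

lemma iidMean_add (N : ℕ) (F G : (Fin N → Ω) → ℝ) :
    iidMean μ N (fun c => F c + G c) = iidMean μ N F + iidMean μ N G := by
  simp [iidMean, mul_add, Finset.sum_add_distrib]

lemma iidMean_const_mul (N : ℕ) (a : ℝ) (F : (Fin N → Ω) → ℝ) :
    iidMean μ N (fun c => a * F c) = a * iidMean μ N F := by
  simp only [iidMean, Finset.mul_sum]
  exact Finset.sum_congr rfl fun c _ => by ring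

lemma iidMean_sum {κ : Type*} (s : Finset κ) (N : ℕ) (F : κ → (Fin N → Ω) → ℝ) :
    iidMean μ N (fun c => ∑ k ∈ s, F k c) = ∑ k ∈ s, iidMean μ N (F k) := by
  simp only [iidMean, Finset.mul_sum]
  exact Finset.sum_comm

lemma sum_iidExt (h1 : ∑ x, μ x = 1) (N : ℕ) : ∑ c, iidExt μ N c = 1 := by
  have := Finset.prod_univ_sum (fun _ : Fin N => (Finset.univ : Finset Ω)) (fun _ x => μ x)
  simp only [Fintype.piFinset_univ, h1, Finset.prod_const_one] at this
  exact this.symm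

lemma iidMean_const (h1 : ∑ x, μ x = 1) (N : ℕ) (a : ℝ) : iidMean μ N (fun _ => a) = a := by
  rw [iidMean, ← Finset.sum_mul, sum_iidExt h1, one_mul]

lemma iidMean_first (h1 : ∑ x, μ x = 1) {g : Ω → ℝ} (hg : ∑ x, μ x * g x = 0) (N : ℕ) :
    iidMean μ N (fun c => ∑ j, g (c j)) = 0 := by
  induction N with
  | zero => simp [iidMean_zero]
  | succ N ih =>
    rw [iidMean_succ]
    simp only [Fin.sum_univ_succ, Fin.cons_zero, Fin.cons_succ, iidMean_add, ih,
      iidMean_const h1, add_zero, hg]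

lemma iidMean_second (h1 : ∑ x, μ x = 1) {g : Ω → ℝ} (hg : ∑ x, μ x * g x = 0) (N : ℕ) :
    iidMean μ N (fun c => (∑ j, g (c j)) ^ 2) = N * ∑ x, μ x * g x ^ 2 := by
  induction N with
  | zero => simp [iidMean_zero]
  | succ N ih =>
    rw [iidMean_succ]
    have key : ∀ x, iidMean μ N (fun c => (∑ j, g ((Fin.cons x c : Fin (N + 1) → Ω) j)) ^ 2)
        = g x ^ 2 + N * ∑ x, μ x * g x ^ 2 := by
      intro x
      have : (fun c : Fin N → Ω => (∑ j, g ((Fin.cons x c : Fin (N + 1) → Ω) j)) ^ 2) =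
          fun c => (g x ^ 2 + (2 * g x) * ∑ j, g (c j)) + (∑ j, g (c j)) ^ 2 := by
        funext c
        simp only [Fin.sum_univ_succ, Fin.cons_zero, Fin.cons_succ]
        ring
      rw [this, iidMean_add, iidMean_add, iidMean_const h1, iidMean_const_mul,
        iidMean_first h1 hg, ih]
      ring
    simp only [key, mul_add, Finset.sum_add_distrib, ← Finset.sum_mul, h1]
    push_cast
    ring

/-- Splitting off one summand, the terms odd in it that are linear are killed by centring (so the
third moment of the rest never matters), while its cube meets a centred sum. Only fourth powers and
products of two squares survive. -/
lemma iidMean_fourth_le (h1 : ∑ x, μ x = 1) {g : Ω → ℝ}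
    (hg : ∑ x, μ x * g x = 0) (N : ℕ) :
    iidMean μ N (fun c => (∑ j, g (c j)) ^ 4) ≤
      N * ∑ x, μ x * g x ^ 4 + 3 * (N * ∑ x, μ x * g x ^ 2) ^ 2 := by
  induction N with
  | zero => simp [iidMean_zero]
  | succ N ih =>
    rw [iidMean_succ]
    set V := ∑ x, μ x * g x ^ 2 with hV
    set K := iidMean μ N (fun c => (∑ j, g (c j)) ^ 4) with hK
    set L := iidMean μ N (fun c => (∑ j, g (c j)) ^ 3) with hL
    have key : ∀ x, iidMean μ N (fun c => (∑ j, g ((Fin.cons x c : Fin (N + 1) → Ω) j)) ^ 4)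
        = g x ^ 4 + 6 * N * V * g x ^ 2 + 4 * L * g x + K := by
      intro x
      have : (fun c : Fin N → Ω => (∑ j, g ((Fin.cons x c : Fin (N + 1) → Ω) j)) ^ 4) =
          fun c => (((g x ^ 4 + (4 * g x ^ 3) * ∑ j, g (c j)) +
            (6 * g x ^ 2) * (∑ j, g (c j)) ^ 2) + (4 * g x) * (∑ j, g (c j)) ^ 3) +
            (∑ j, g (c j)) ^ 4 := by
        funext c
        simp only [Fin.sum_univ_succ, Fin.cons_zero, Fin.cons_succ]
        ring
      rw [this, iidMean_add, iidMean_add, iidMean_add, iidMean_add, iidMean_const h1,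
        iidMean_const_mul, iidMean_const_mul, iidMean_const_mul,
        iidMean_first h1 hg, iidMean_second h1 hg, ← hK, ← hL, ← hV]
      ring
    have e : ∑ x, μ x * (g x ^ 4 + 6 * N * V * g x ^ 2 + 4 * L * g x + K) =
        (∑ x, μ x * g x ^ 4) + 6 * N * V * V + K := by
      have : ∀ x, μ x * (g x ^ 4 + 6 * N * V * g x ^ 2 + 4 * L * g x + K) =
        μ x * g x ^ 4 + 6 * N * V * (μ x * g x ^ 2) + 4 * L * (μ x * g x) + K * μ x := by
        intro x; ring
      simp only [this, Finset.sum_add_distrib, ← Finset.mul_sum, hg, h1, ← hV]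
      ring
    simp only [key, e]
    push_cast
    nlinarith [sq_nonneg V]

lemma iidMean_abs_le_sqrt (hμ : ∀ x, 0 ≤ μ x) (h1 : ∑ x, μ x = 1) {g : Ω → ℝ}
    (hg : ∑ x, μ x * g x = 0) (N : ℕ) :
    iidMean μ N (fun c => |∑ j, g (c j)|) ≤ √(N * ∑ x, μ x * g x ^ 2) := by
  apply Real.le_sqrt_of_sq_le
  rw [← iidMean_second h1 hg]
  have := Finset.sum_mul_sq_le_sq_mul_sq Finset.univ (fun c => √(iidExt μ N c))
    (fun c => √(iidExt μ N c) * |∑ j, g (c j)|)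
  have hs : ∀ c, √(iidExt μ N c) ^ 2 = iidExt μ N c := fun c =>
    Real.sq_sqrt (iidExt_nonneg hμ N c)
  simp only [mul_pow, ← mul_assoc, ← pow_two, hs, sum_iidExt h1, sq_abs, one_mul] at this
  exact this

/-- Convex-order comparison, tested on the functions u ↦ |t + u| only. The summands are exchanged
one at a time, the remaining sum being absorbed into the shift t. -/
lemma iidMean_abs_mono (hμ : ∀ x, 0 ≤ μ x) {f g : Ω → ℝ}
    (h : ∀ t, ∑ x, μ x * |t + g x| ≤ ∑ x, μ x * |t + f x|) (N : ℕ) (t : ℝ) :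
    iidMean μ N (fun c => |t + ∑ j, g (c j)|) ≤ iidMean μ N (fun c => |t + ∑ j, f (c j)|) := by
  induction N generalizing t with
  | zero => simp [iidMean_zero]
  | succ N ih =>
    rw [iidMean_succ, iidMean_succ]
    simp only [Fin.sum_univ_succ, Fin.cons_zero, Fin.cons_succ]
    calc ∑ x, μ x * iidMean μ N (fun c => |t + (g x + ∑ j, g (c j))|)
        = iidMean μ N (fun c => ∑ x, μ x * |(t + ∑ j, g (c j)) + g x|) := by
          rw [iidMean_sum]
          refine Finset.sum_congr rfl fun x _ => ?_
          rw [iidMean_const_mul]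
          congr 2; funext c; congr 1; ring
      _ ≤ iidMean μ N (fun c => ∑ x, μ x * |(t + ∑ j, g (c j)) + f x|) :=
          iidMean_mono hμ fun c => h _
      _ = ∑ x, μ x * iidMean μ N (fun c => |(t + f x) + ∑ j, g (c j)|) := by
          rw [iidMean_sum]
          refine Finset.sum_congr rfl fun x _ => ?_
          rw [iidMean_const_mul]
          congr 2; funext c; congr 1; ring
      _ ≤ ∑ x, μ x * iidMean μ N (fun c => |(t + f x) + ∑ j, f (c j)|) :=
          Finset.sum_le_sum fun x _ => mul_le_mul_of_nonneg_left (ih _) (hμ x)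
      _ = _ := by simp only [add_assoc]

/-- Lower bound on the first absolute moment from the second and the fourth. -/
lemma le_iidMean_abs_of_moments (hμ : ∀ x, 0 ≤ μ x) {N : ℕ} {S : (Fin N → Ω) → ℝ} {v : ℝ}
    (hv : 0 ≤ v) (h2 : iidMean μ N (fun c => S c ^ 2) = v)
    (h4 : iidMean μ N (fun c => S c ^ 4) ≤ v + 3 * v ^ 2) :
    3 / 4 * v / √(3 * v + 1) ≤ iidMean μ N (fun c => |S c|) := by
  set τ := √(3 * v + 1) with hτ
  have hτ2 : τ ^ 2 = 3 * v + 1 := Real.sq_sqrt (by positivity)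
  have hτ0 : 0 < τ := Real.sqrt_pos.2 (by positivity)
  -- With |u| = rτ this is r² - r⁴/4 ≤ r. The scale τ² = 3v + 1 turns the fourth-moment bound into
  -- vτ², so that exactly 3/4 of v/τ survives.
  have hp : ∀ u : ℝ, 1 / τ * u ^ 2 + (-(1 / (4 * τ ^ 3))) * u ^ 4 ≤ |u| := by
    intro u
    obtain ⟨w, hw⟩ : ∃ w, w = |u| := ⟨_, rfl⟩
    have hw0 : 0 ≤ w := hw ▸ abs_nonneg u
    have e2 : u ^ 2 = w ^ 2 := by rw [hw, sq_abs]
    have e4 : u ^ 4 = w ^ 4 := by rw [show u ^ 4 = (u ^ 2) ^ 2 by ring, e2]; ring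
    rw [e2, e4, ← hw]
    obtain ⟨r, rfl⟩ : ∃ r, w = r * τ := ⟨w / τ, by field_simp⟩
    have hr : 0 ≤ r := nonneg_of_mul_nonneg_left hw0 hτ0
    have : 1 / τ * (r * τ) ^ 2 + -(1 / (4 * τ ^ 3)) * (r * τ) ^ 4 =
        (r ^ 2 - r ^ 4 / 4) * τ := by field_simp; ring
    rw [this]
    apply mul_le_mul_of_nonneg_right _ hτ0.le
    have h3 : 0 ≤ 1 - r + r ^ 3 / 4 := by
      nlinarith [mul_nonneg hr (sq_nonneg (r - 1)), sq_nonneg (r - 1), sq_nonneg (2 * r - 2)]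
    nlinarith [mul_nonneg hr h3]
  calc 3 / 4 * v / τ = 1 / τ * v + (-(1 / (4 * τ ^ 3))) * (v + 3 * v ^ 2) := by
        rw [show v + 3 * v ^ 2 = v * τ ^ 2 by rw [hτ2]; ring]
        field_simp
        ring
    _ ≤ 1 / τ * v + (-(1 / (4 * τ ^ 3))) * iidMean μ N (fun c => S c ^ 4) := by
        have : 0 ≤ 1 / (4 * τ ^ 3) := by positivity
        nlinarith
    _ = iidMean μ N (fun c => 1 / τ * S c ^ 2 + (-(1 / (4 * τ ^ 3))) * S c ^ 4) := by
        rw [iidMean_add, iidMean_const_mul, iidMean_const_mul, h2]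
    _ ≤ _ := iidMean_mono hμ fun c => hp _

end IidSums

/-! ### Mean absolute deviation of an empirical average, from above and below. -/

section Averages

variable {Ω : Type*} [Fintype Ω] {μ : Ω → ℝ}

lemma sum_mul_sub_mean (h1 : ∑ x, μ x = 1) (f : Ω → ℝ) :
    ∑ x, μ x * (f x - ∑ z, μ z * f z) = 0 := by
  simp [mul_sub, Finset.sum_sub_distrib, ← Finset.sum_mul, h1]

lemma iidMean_sum_apply (h1 : ∑ x, μ x = 1) (f : Ω → ℝ) (N : ℕ) :
    iidMean μ N (fun c => ∑ j, f (c j)) = N * ∑ x, μ x * f x := by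
  have h := iidMean_first h1 (sum_mul_sub_mean h1 f) N
  simp only [Finset.sum_sub_distrib, Finset.sum_const, Finset.card_univ, Fintype.card_fin,
    nsmul_eq_mul] at h
  simp only [sub_eq_add_neg, iidMean_add, iidMean_const h1] at h
  linarith

lemma variance_le (h1 : ∑ x, μ x = 1) (f : Ω → ℝ) :
    ∑ x, μ x * (f x - ∑ z, μ z * f z) ^ 2 ≤ ∑ x, μ x * f x ^ 2 := by
  set m := ∑ z, μ z * f z with hm
  have : ∀ x, μ x * (f x - m) ^ 2 = μ x * f x ^ 2 - 2 * m * (μ x * f x) + m ^ 2 * μ x := by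
    intro x; ring
  simp only [this, Finset.sum_add_distrib, Finset.sum_sub_distrib, ← Finset.mul_sum, h1, ← hm]
  nlinarith [sq_nonneg m]

/-- The mean absolute deviation of an empirical average of nonnegative variables is at most three
times its bound for `l`-th moments, `1 ≤ l ≤ 2`. -/
lemma iidMean_abs_average_le (hμ : ∀ x, 0 ≤ μ x) (h1 : ∑ x, μ x = 1) {f : Ω → ℝ}
    (hf : ∀ x, 0 ≤ f x) {N : ℕ} (hN : 0 < N) {l : ℝ} (hl1 : 1 ≤ l) (hl2 : l ≤ 2) :
    iidMean μ N (fun c => |1 / (N : ℝ) * ∑ j, f (c j) - ∑ x, μ x * f x|) ≤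
      3 * (N : ℝ) ^ (1 / l - 1) * (∑ x, μ x * f x ^ l) ^ (1 / l) := by
  have hN' : (0 : ℝ) < N := by exact_mod_cast hN
  set m := ∑ x, μ x * f x with hm
  set K := ∑ x, μ x * f x ^ l with hK
  have hK0 : 0 ≤ K := Finset.sum_nonneg fun x _ => mul_nonneg (hμ x) (Real.rpow_nonneg (hf x) _)
  have hm0 : 0 ≤ m := Finset.sum_nonneg fun x _ => mul_nonneg (hμ x) (hf x)
  have hl0 : 0 < l := by linarith
  -- Any minorant A of f splits it: the fluctuation of A is bounded by its variance, and the excess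
  -- f - A is paid for twice, once in the sum and once in the mean.
  have general : ∀ A : Ω → ℝ, (∀ x, A x ≤ f x) →
      iidMean μ N (fun c => |1 / (N : ℝ) * ∑ j, f (c j) - m|) ≤
        1 / N * (√(N * ∑ x, μ x * A x ^ 2) + 2 * (N * ∑ x, μ x * (f x - A x))) := by
    intro A hA
    set a := ∑ x, μ x * A x with ha
    have hb : ∑ x, μ x * (f x - A x) = m - a := by
      simp [mul_sub, Finset.sum_sub_distrib, hm, ha]
    have hb0 : 0 ≤ ∑ x, μ x * (f x - A x) :=
      Finset.sum_nonneg fun x _ => mul_nonneg (hμ x) (sub_nonneg.2 (hA x))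
    calc iidMean μ N (fun c => |1 / (N : ℝ) * ∑ j, f (c j) - m|)
        ≤ iidMean μ N (fun c => 1 / (N : ℝ) * ((|∑ j, (A (c j) - a)| + ∑ j, (f (c j) - A (c j)))
            + N * (m - a))) := by
          refine iidMean_mono hμ fun c => ?_
          have hs : 0 ≤ ∑ j, (f (c j) - A (c j)) :=
            Finset.sum_nonneg fun j _ => sub_nonneg.2 (hA _)
          have : 1 / (N : ℝ) * ∑ j, f (c j) - m = 1 / (N : ℝ) * ((∑ j, (A (c j) - a) +
              ∑ j, (f (c j) - A (c j))) - N * (m - a)) := by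
            simp only [Finset.sum_sub_distrib, Finset.sum_const, Finset.card_univ,
              Fintype.card_fin, nsmul_eq_mul]
            field_simp
            ring
          rw [this, abs_mul, abs_of_pos (by positivity : 0 < 1 / (N : ℝ))]
          refine mul_le_mul_of_nonneg_left ?_ (by positivity)
          have hma : 0 ≤ N * (m - a) := mul_nonneg hN'.le (hb ▸ hb0)
          refine (abs_sub _ _).trans ?_
          rw [abs_of_nonneg hma]
          have := abs_add_le (∑ j, (A (c j) - a)) (∑ j, (f (c j) - A (c j)))
          rw [abs_of_nonneg hs] at this
          linarith
      _ = 1 / N * (iidMean μ N (fun c => |∑ j, (A (c j) - a)|) +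
            2 * (N * ∑ x, μ x * (f x - A x))) := by
          rw [iidMean_const_mul, iidMean_add, iidMean_add, iidMean_const h1,
            iidMean_sum_apply h1 (fun x => f x - A x), hb]
          ring
      _ ≤ _ := by
          refine mul_le_mul_of_nonneg_left (add_le_add_left ?_ _) (by positivity)
          refine (iidMean_abs_le_sqrt hμ h1 (sum_mul_sub_mean h1 A) N).trans
            (Real.sqrt_le_sqrt ?_)
          exact mul_le_mul_of_nonneg_left (variance_le h1 A) hN'.le
  rcases hK0.eq_or_lt with h0 | hKpos
  · have hz : ∀ x, μ x * f x = 0 := by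
      intro x
      have := (Finset.sum_eq_zero_iff_of_nonneg (fun x _ =>
        mul_nonneg (hμ x) (Real.rpow_nonneg (hf x) l))).1 h0.symm x (Finset.mem_univ x)
      rcases mul_eq_zero.1 this with h | h
      · simp [h]
      · simp [(Real.rpow_eq_zero (hf x) hl0.ne').1 h]
    refine (general 0 hf).trans ?_
    have : 0 ≤ 3 * (N : ℝ) ^ (1 / l - 1) * K ^ (1 / l) := by positivity
    simpa [hz] using this
  -- The truncation level at which τ^l = NK: the standard deviation of the truncated sum and the
  -- mean of the total excess are then both at most τ, whence the factor 3 = 1 + 2.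
  set τ := (N * K) ^ (1 / l) with hτ
  have hτ0 : 0 < τ := by positivity
  have hτl : τ ^ l = N * K := by
    rw [hτ, ← Real.rpow_mul (by positivity), one_div_mul_cancel hl0.ne', Real.rpow_one]
  classical
  refine (general (fun x => if f x ≤ τ then f x else 0) fun x => ?_).trans ?_
  · split_ifs
    exacts [le_rfl, hf x]
  have e1 : N * ∑ x, μ x * (if f x ≤ τ then f x else 0) ^ 2 ≤ τ ^ 2 := by
    have : ∑ x, μ x * (if f x ≤ τ then f x else 0) ^ 2 ≤ τ ^ (2 - l) * K := by
      rw [hK, Finset.mul_sum]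
      refine Finset.sum_le_sum fun x _ => ?_
      rw [mul_left_comm]
      refine mul_le_mul_of_nonneg_left ?_ (hμ x)
      split_ifs with h
      · rcases (hf x).eq_or_lt with h0 | hpos
        · rw [← h0]; simp only [ne_eq, OfNat.ofNat_ne_zero, not_false_eq_true, zero_pow]
          positivity
        · calc f x ^ 2 = f x ^ (2 - l) * f x ^ l := by
                rw [← Real.rpow_add hpos]; norm_num
            _ ≤ _ := by
                gcongr
      · have := Real.rpow_nonneg (hf x) l
        simp only [ne_eq, OfNat.ofNat_ne_zero, not_false_eq_true, zero_pow]
        positivity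
    calc N * ∑ x, μ x * (if f x ≤ τ then f x else 0) ^ 2 ≤ N * (τ ^ (2 - l) * K) := by gcongr
      _ = τ ^ (2 - l) * τ ^ l := by rw [hτl]; ring
      _ = τ ^ 2 := by rw [← Real.rpow_add hτ0]; norm_num
  have e2 : N * ∑ x, μ x * (f x - if f x ≤ τ then f x else 0) ≤ τ := by
    have : ∑ x, μ x * (f x - if f x ≤ τ then f x else 0) ≤ τ ^ (1 - l) * K := by
      rw [hK, Finset.mul_sum]
      refine Finset.sum_le_sum fun x _ => ?_
      rw [mul_left_comm]
      refine mul_le_mul_of_nonneg_left ?_ (hμ x)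
      have := Real.rpow_nonneg (hf x) l
      split_ifs with h
      · rw [sub_self]; positivity
      · push Not at h
        rw [sub_zero]
        calc f x = f x ^ (1 - l) * f x ^ l := by
              rw [← Real.rpow_add (hτ0.trans h)]; norm_num
          _ ≤ _ := mul_le_mul_of_nonneg_right
              (Real.rpow_le_rpow_of_nonpos hτ0 h.le (by linarith)) this
    calc N * ∑ x, μ x * (f x - if f x ≤ τ then f x else 0) ≤ N * (τ ^ (1 - l) * K) := by gcongr
      _ = τ ^ (1 - l) * τ ^ l := by rw [hτl]; ring
      _ = τ := by rw [← Real.rpow_add hτ0]; norm_num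
  calc _ ≤ 1 / N * (τ + 2 * τ) := by
        gcongr
        exact Real.sqrt_le_iff.2 ⟨hτ0.le, e1⟩
    _ = 3 * (N : ℝ) ^ (1 / l - 1) * K ^ (1 / l) := by
        rw [hτ, Real.mul_rpow hN'.le hK0, Real.rpow_sub_one hN'.ne']
        field_simp
        ring

/-- Lower bound on the mean absolute deviation of an empirical average, by conditioning on the
number of samples that fall into `A`. -/
lemma le_iidMean_abs_average (hμ : ∀ x, 0 ≤ μ x) (h1 : ∑ x, μ x = 1) (f : Ω → ℝ) (A : Finset Ω)
    {N : ℕ} (hN : 0 < N) :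
    3 / 4 * |∑ x ∈ A, μ x * (f x - ∑ z, μ z * f z)| / √(3 * (N * ∑ x ∈ A, μ x) + 1) ≤
      iidMean μ N (fun c => |1 / (N : ℝ) * ∑ j, f (c j) - ∑ x, μ x * f x|) := by
  classical
  have hN' : (0 : ℝ) < N := by exact_mod_cast hN
  set m := ∑ x, μ x * f x with hm
  set p := ∑ x ∈ A, μ x with hp
  set D := ∑ x ∈ A, μ x * (f x - m) with hD
  have hp0 : 0 ≤ p := Finset.sum_nonneg fun x _ => hμ x
  have hpc : ∑ x ∈ Aᶜ, μ x = 1 - p := by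
    have := Finset.sum_add_sum_compl A μ
    linarith
  have hp1 : 0 ≤ 1 - p := hpc ▸ Finset.sum_nonneg fun x _ => hμ x
  have hDc : ∑ x ∈ Aᶜ, μ x * (f x - m) = -D := by
    have := Finset.sum_add_sum_compl A (fun x => μ x * (f x - m))
    rw [sum_mul_sub_mean h1 f] at this
    linarith
  have hrhs : 0 ≤ iidMean μ N (fun c => |1 / (N : ℝ) * ∑ j, f (c j) - m|) :=
    Finset.sum_nonneg fun c _ => mul_nonneg (iidExt_nonneg hμ N c) (abs_nonneg _)
  have hzero : ∀ B : Finset Ω, ∑ x ∈ B, μ x = 0 → ∑ x ∈ B, μ x * (f x - m) = 0 := by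
    intro B hB
    refine Finset.sum_eq_zero fun x hx => ?_
    rw [(Finset.sum_eq_zero_iff_of_nonneg fun x _ => hμ x).1 hB x hx, zero_mul]
  rcases hp0.eq_or_lt with h0 | hp0'
  · have : D = 0 := hzero A h0.symm
    simpa [this] using hrhs
  rcases hp1.eq_or_lt with h0 | hp1'
  · have : D = 0 := by have := hzero Aᶜ (hpc.trans h0.symm); linarith
    simpa [this] using hrhs
  set g : Ω → ℝ := fun x => (if x ∈ A then 1 else 0) - p with hg
  -- With this slope, `k * g` is the conditional mean of f - m given the indicator of A: it is D/p
  -- on A and -D/(1-p) off A.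
  set k := D / (p * (1 - p)) with hk
  set v := N * (p * (1 - p)) with hv
  have split : ∀ F : Ω → ℝ, ∑ x, μ x * F x = ∑ x ∈ A, μ x * F x + ∑ x ∈ Aᶜ, μ x * F x :=
    fun F => (Finset.sum_add_sum_compl A _).symm
  have onA : ∀ φ : ℝ → ℝ, ∑ x ∈ A, μ x * φ (g x) = p * φ (1 - p) := by
    intro φ
    rw [show p * φ (1 - p) = ∑ x ∈ A, μ x * φ (1 - p) from Finset.sum_mul ..]
    refine Finset.sum_congr rfl fun x hx => by simp [hg, hx]
  have onAc : ∀ φ : ℝ → ℝ, ∑ x ∈ Aᶜ, μ x * φ (g x) = (1 - p) * φ (-p) := by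
    intro φ
    rw [← hpc, Finset.sum_mul]
    refine Finset.sum_congr rfl fun x hx => by simp [hg, Finset.mem_compl.1 hx]
  have g1 : ∑ x, μ x * g x = 0 := by
    rw [split, onA (fun u => u), onAc (fun u => u)]; ring
  have g2 : ∑ x, μ x * g x ^ 2 = p * (1 - p) := by
    rw [split, onA (fun u => u ^ 2), onAc (fun u => u ^ 2)]; ring
  -- Since |g| ≤ 1, the fourth moment is dominated by the second, which is the form that
  -- `le_iidMean_abs_of_moments` needs.
  have g4 : ∑ x, μ x * g x ^ 4 ≤ p * (1 - p) := by
    rw [split, onA (fun u => u ^ 4), onAc (fun u => u ^ 4)]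
    have : p * (1 - p) - (p * (1 - p) ^ 4 + (1 - p) * (-p) ^ 4) =
      3 * (p * (1 - p)) ^ 2 := by ring
    nlinarith [sq_nonneg (p * (1 - p))]
  have hmono := iidMean_abs_mono (μ := μ) hμ (f := fun x => f x - m) (g := fun x => k * g x) ?_ N 0
  · simp only [zero_add, ← Finset.mul_sum, abs_mul, iidMean_const_mul] at hmono
    have hmom := le_iidMean_abs_of_moments (μ := μ) hμ (N := N) (S := fun c => ∑ j, g (c j))
      (v := v) (by positivity) (by rw [iidMean_second h1 g1, g2]) (by
        refine (iidMean_fourth_le h1 g1 N).trans ?_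
        rw [g2]
        exact add_le_add_left (mul_le_mul_of_nonneg_left g4 hN'.le) _)
    have e : iidMean μ N (fun c => |1 / (N : ℝ) * ∑ j, f (c j) - m|) =
        1 / N * iidMean μ N (fun c => |∑ j, (f (c j) - m)|) := by
      rw [← iidMean_const_mul]
      congr 1; funext c
      rw [← abs_of_pos (by positivity : 0 < 1 / (N : ℝ)), ← abs_mul,
        abs_of_pos (by positivity : 0 < 1 / (N : ℝ))]
      congr 1
      simp only [Finset.sum_sub_distrib, Finset.sum_const, Finset.card_univ,
        Fintype.card_fin, nsmul_eq_mul]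
      field_simp
    rw [e]
    calc 3 / 4 * |D| / √(3 * (N * p) + 1) ≤ 3 / 4 * |D| / √(3 * v + 1) := by
          have : v ≤ N * p := by
            rw [hv]
            exact mul_le_mul_of_nonneg_left (by nlinarith) hN'.le
          gcongr
      _ = 1 / N * (|k| * (3 / 4 * v / √(3 * v + 1))) := by
          rw [hk, abs_div, abs_of_pos (by positivity : 0 < p * (1 - p)), hv]
          field_simp
      _ ≤ 1 / N * (|k| * iidMean μ N (fun c => |∑ j, g (c j)|)) := by gcongr
      _ ≤ _ := by gcongr
  -- Jensen's inequality for the conditional mean: the triangle inequality on each of the two cells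
  -- A and Aᶜ.
  · intro t
    rw [split, split, onA (fun u => |t + k * u|), onAc (fun u => |t + k * u|)]
    refine add_le_add ?_ ?_
    · calc p * |t + k * (1 - p)| = |∑ x ∈ A, μ x * (t + (f x - m))| := by
            simp only [mul_add, Finset.sum_add_distrib, ← Finset.sum_mul]
            rw [← hD, ← hp, hk]
            nth_rewrite 1 [← abs_of_pos hp0']
            rw [← abs_mul]
            congr 1
            field_simp
        _ ≤ _ := (Finset.abs_sum_le_sum_abs _ _).trans_eq
            (Finset.sum_congr rfl fun x _ => by rw [abs_mul, abs_of_nonneg (hμ x)])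
    · calc (1 - p) * |t + k * (-p)| = |∑ x ∈ Aᶜ, μ x * (t + (f x - m))| := by
            simp only [mul_add, Finset.sum_add_distrib, ← Finset.sum_mul]
            rw [hDc, hpc, hk]
            nth_rewrite 1 [← abs_of_pos hp1']
            rw [← abs_mul]
            congr 1
            field_simp
        _ ≤ _ := (Finset.abs_sum_le_sum_abs _ _).trans_eq
            (Finset.sum_congr rfl fun x _ => by rw [abs_mul, abs_of_nonneg (hμ x)])

end Averages

/-! ### Product structure and achievability. -/

lemma sum_prod_apply {A : Type*} [Fintype A] {n : ℕ} (F : Fin n → A → ℝ) :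
    ∑ x : Fin n → A, ∏ i, F i (x i) = ∏ i, ∑ a, F i a := by
  classical
  have := Finset.prod_univ_sum (fun _ : Fin n => (Finset.univ : Finset A)) F
  simp only [Fintype.piFinset_univ] at this
  exact this.symm

lemma outputDist_ext {X Y : Type*} [Fintype X] {P : X → ℝ} {W : X → Y → ℝ} (n : ℕ) :
    outputDist (iidExt P n) (memorylessExt W n) = iidExt (outputDist P W) n := by
  funext y
  simp only [outputDist, iidExt, memorylessExt, ← Finset.prod_mul_distrib]
  exact sum_prod_apply fun i x => P x * W x (y i)

section Channel

variable {X Y : Type*} [Fintype X] [Fintype Y] {P : X → ℝ} {W : X → Y → ℝ}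

/-- `∑ y, (∑ x, P x * W x y ^ l) ^ (1 / l)`, the sum inside Sibson's information of order `l`. -/
def sibsonSum (P : X → ℝ) (W : X → Y → ℝ) (l : ℝ) : ℝ :=
  ∑ y, (∑ x, P x * W x y ^ l) ^ (1 / l)

lemma expectedDist_eq (n M : ℕ) :
    expectedDist P W n M = ∑ y, iidMean (iidExt P n) M (fun c =>
      |1 / (M : ℝ) * ∑ j, memorylessExt W n (c j) y -
        ∑ x, iidExt P n x * memorylessExt W n x y|) := by
  rw [← iidMean_sum]
  rfl

lemma outputDist_mem (hP : P ∈ stdSimplex ℝ X) (hW : ∀ x, W x ∈ stdSimplex ℝ Y) :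
    outputDist P W ∈ stdSimplex ℝ Y := by
  refine ⟨fun y => Finset.sum_nonneg fun x _ => mul_nonneg (hP.1 x) ((hW x).1 y), ?_⟩
  simp only [outputDist]
  rw [Finset.sum_comm]
  simp [← Finset.mul_sum, (hW _).2, hP.2]

lemma jointDist_mem (hP : P ∈ stdSimplex ℝ X) (hW : ∀ x, W x ∈ stdSimplex ℝ Y) :
    jointDist P W ∈ stdSimplex ℝ (X × Y) := by
  refine ⟨fun z => mul_nonneg (hP.1 _) ((hW _).1 _), ?_⟩
  simp only [jointDist, Fintype.sum_prod_type]
  simp [← Finset.mul_sum, (hW _).2, hP.2]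

lemma exists_joint_pos (hP : P ∈ stdSimplex ℝ X) (hW : ∀ x, W x ∈ stdSimplex ℝ Y) :
    ∃ x y, 0 < P x ∧ 0 < W x y := by
  by_contra! h
  have h0 : ∑ z, jointDist P W z = 0 := by
    refine Finset.sum_eq_zero fun z _ => ?_
    rcases (hP.1 z.1).eq_or_lt with h0 | hpos
    · simp [jointDist, ← h0]
    · simp [jointDist, le_antisymm (h z.1 z.2 hpos) ((hW _).1 _)]
  linarith [(jointDist_mem hP hW).2]

lemma sibsonSum_pos (hP : P ∈ stdSimplex ℝ X) (hW : ∀ x, W x ∈ stdSimplex ℝ Y) (l : ℝ) :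
    0 < sibsonSum P W l := by
  obtain ⟨x, y, hx, hy⟩ := exists_joint_pos hP hW
  have hnn : ∀ y x, 0 ≤ P x * W x y ^ l := fun y x =>
    mul_nonneg (hP.1 x) (Real.rpow_nonneg ((hW x).1 y) _)
  refine Finset.sum_pos' (fun y _ => Real.rpow_nonneg (Finset.sum_nonneg fun x _ => hnn y x) _)
    ⟨y, Finset.mem_univ y, Real.rpow_pos_of_pos ?_ _⟩
  exact Finset.sum_pos' (fun x _ => hnn y x)
    ⟨x, Finset.mem_univ x, mul_pos hx (Real.rpow_pos_of_pos hy _)⟩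

/-- Single-letterization: both the inner sum over input words and the outer sum over output words
factor over coordinates, so the achievability exponent is linear in n. -/
lemma sibsonSum_ext (hP : P ∈ stdSimplex ℝ X) (hW : ∀ x, W x ∈ stdSimplex ℝ Y) (n : ℕ) (l : ℝ) :
    sibsonSum (iidExt P n) (memorylessExt W n) l = sibsonSum P W l ^ n := by
  have e : ∀ y : Fin n → Y, (∑ x, iidExt P n x * memorylessExt W n x y ^ l) ^ (1 / l) =
      ∏ i, (∑ x, P x * W x (y i) ^ l) ^ (1 / l) := by
    intro y
    rw [Real.finsetProd_rpow _ _ fun i _ => Finset.sum_nonneg fun x _ =>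
      mul_nonneg (hP.1 x) (Real.rpow_nonneg ((hW x).1 _) _)]
    congr 1
    rw [← sum_prod_apply fun i x => P x * W x (y i) ^ l]
    refine Finset.sum_congr rfl fun x _ => ?_
    rw [Finset.prod_mul_distrib, Real.finsetProd_rpow _ _ fun i _ => (hW _).1 _]
    rfl
  simp only [sibsonSum, e]
  rw [sum_prod_apply fun _ y => (∑ x, P x * W x y ^ l) ^ (1 / l)]
  simp

/-- Achievability: exponential upper bound on the expected distance. -/
lemma expectedDist_le (hP : P ∈ stdSimplex ℝ X) (hW : ∀ x, W x ∈ stdSimplex ℝ Y) {l : ℝ}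
    (hl1 : 1 ≤ l) (hl2 : l ≤ 2) (R : ℝ) (n : ℕ) :
    expectedDist P W n ⌈Real.exp (n * R)⌉₊ ≤
      3 * Real.exp (-(n * ((l - 1) / l * R - Real.log (sibsonSum P W l)))) := by
  have hM : 0 < ⌈Real.exp (n * R)⌉₊ := Nat.ceil_pos.2 (Real.exp_pos _)
  have hMge := Nat.le_ceil (Real.exp (n * R))
  generalize ⌈Real.exp (n * R)⌉₊ = M at hM hMge
  have hl0 : 0 < l := by linarith
  calc expectedDist P W n M
      ≤ ∑ y, 3 * (M : ℝ) ^ (1 / l - 1) *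
          (∑ x, iidExt P n x * memorylessExt W n x y ^ l) ^ (1 / l) := by
        rw [expectedDist_eq]
        exact Finset.sum_le_sum fun y _ => iidMean_abs_average_le (iidExt_nonneg hP.1 n)
          (sum_iidExt hP.2 n)
          (f := fun x => memorylessExt W n x y) (fun x => Finset.prod_nonneg fun i _ => (hW _).1 _) hM hl1 hl2
    _ = 3 * (M : ℝ) ^ (1 / l - 1) * sibsonSum P W l ^ n := by
        rw [← Finset.mul_sum, ← sibsonSum_ext hP hW, sibsonSum]
    _ ≤ 3 * Real.exp (n * R) ^ (1 / l - 1) * sibsonSum P W l ^ n := by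
        have hZ := sibsonSum_pos hP hW l
        have : (M : ℝ) ^ (1 / l - 1) ≤ Real.exp (n * R) ^ (1 / l - 1) := by
          refine Real.rpow_le_rpow_of_nonpos (Real.exp_pos _) hMge ?_
          rw [sub_nonpos, div_le_one hl0]
          exact hl1
        gcongr
    _ = _ := by
        have hZ := sibsonSum_pos hP hW l
        rw [← Real.exp_mul, mul_assoc]
        nth_rewrite 1 [← Real.exp_log hZ]
        rw [← Real.exp_nat_mul, ← Real.exp_add]
        congr 2
        field_simp
        ring

end Channel

/-! ### Typicality and the converse for a fixed joint law. -/

/-- Weak law of large numbers, simultaneously for a finite family of functions. -/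
lemma eventually_typical {Ω ι : Type*} [Fintype Ω] [Fintype ι] {μ : Ω → ℝ}
    (hμ : μ ∈ stdSimplex ℝ Ω) (h : ι → Ω → ℝ) {δ : ℝ} (hδ : 0 < δ) :
    ∀ᶠ n : ℕ in Filter.atTop, 1 / 2 ≤ iidMean μ n (fun z => open Classical in
      if ∀ k, |∑ i, h k (z i) - n * ∑ a, μ a * h k a| ≤ n * δ then 1 else 0) := by
  classical
  set V := ∑ k, ∑ a, μ a * (h k a - ∑ a, μ a * h k a) ^ 2 with hV
  filter_upwards [Filter.eventually_gt_atTop 0,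
    Filter.eventually_ge_atTop ⌈2 * V / δ ^ 2⌉₊] with n hn0 hn
  have hn0' : (0 : ℝ) < n := by exact_mod_cast hn0
  have hnV : 2 * V / δ ^ 2 ≤ n := (Nat.le_ceil _).trans (by exact_mod_cast hn)
  -- Chebyshev's inequality in pointwise form, with a union bound over the family built in; the
  -- choice of n makes the failure probability at most 1/2.
  have hbound : ∀ z : Fin n → Ω, 1 + (-(1 / (n * δ) ^ 2)) *
      (∑ k, (∑ i, (h k (z i) - ∑ a, μ a * h k a)) ^ 2) ≤
      if ∀ k, |∑ i, h k (z i) - n * ∑ a, μ a * h k a| ≤ n * δ then (1 : ℝ) else 0 := by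
    intro z
    have hnn : 0 ≤ ∑ k, (∑ i, (h k (z i) - ∑ a, μ a * h k a)) ^ 2 :=
      Finset.sum_nonneg fun k _ => sq_nonneg _
    have hp : 0 < 1 / (n * δ) ^ 2 := by positivity
    split_ifs with hz
    · nlinarith
    · push Not at hz
      obtain ⟨k, hk⟩ := hz
      have h1 : (n * δ) ^ 2 ≤ (∑ i, (h k (z i) - ∑ a, μ a * h k a)) ^ 2 := by
        rw [Finset.sum_sub_distrib, Finset.sum_const, Finset.card_univ, Fintype.card_fin,
          nsmul_eq_mul, ← sq_abs (_ - _)]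
        exact pow_le_pow_left₀ (by positivity) hk.le 2
      have h2 := Finset.single_le_sum (f := fun k => (∑ i, (h k (z i) - ∑ a, μ a * h k a)) ^ 2)
        (fun k _ => sq_nonneg _) (Finset.mem_univ k)
      have h3 := mul_le_mul_of_nonneg_left (h1.trans h2) hp.le
      rw [one_div_mul_cancel (by positivity)] at h3
      linarith
  refine le_trans ?_ (iidMean_mono hμ.1 hbound)
  rw [iidMean_add, iidMean_const hμ.2, iidMean_const_mul, iidMean_sum]
  simp only [iidMean_second hμ.2 (sum_mul_sub_mean hμ.2 _), ← Finset.mul_sum]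
  rw [← hV]
  have : 1 / (n * δ) ^ 2 * (n * V) ≤ 1 / 2 := by
    rw [div_le_iff₀ (by positivity)] at hnV
    rw [mul_pow, one_div_mul_eq_div, div_le_iff₀ (by positivity)]
    nlinarith
  linarith

/-- The sum `∑ a, p a log (p a / q a)`. -/
def klSum {A : Type*} [Fintype A] (p q : A → ℝ) : ℝ := ∑ a, p a * Real.log (p a / q a)

lemma le_sndMarginal {X Y : Type*} [Fintype X] {Q : X × Y → ℝ} (hQ : ∀ z, 0 ≤ Q z) (z : X × Y) : Q z ≤ sndMarginal Q z.2 :=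
  Finset.single_le_sum (f := fun x => Q (x, z.2)) (fun _ _ => hQ _) (Finset.mem_univ z.1)

lemma prod_eq_mul_exp {n : ℕ} {p q : Fin n → ℝ} (hp : ∀ i, 0 < p i) (hq : ∀ i, 0 < q i) :
    ∏ i, p i = (∏ i, q i) * Real.exp (∑ i, Real.log (p i / q i)) := by
  rw [Real.exp_sum, ← Finset.prod_mul_distrib]
  refine Finset.prod_congr rfl fun i _ => ?_
  rw [Real.exp_log (div_pos (hp i) (hq i)), mul_div_cancel₀ _ (hq i).ne']

/-- On A all differences f - m have the same sign, so nothing cancels, and each is at least f/2 in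
absolute value. -/
lemma half_sum_le_abs {Ω : Type*} {A : Finset Ω} {μ f : Ω → ℝ} (hμ : ∀ x, 0 ≤ μ x)
    (hf : ∀ x, 0 ≤ f x) {m : ℝ} (h : (∀ x ∈ A, 2 * m ≤ f x) ∨ ∀ x ∈ A, 2 * f x ≤ m) :
    1 / 2 * ∑ x ∈ A, μ x * f x ≤ |∑ x ∈ A, μ x * (f x - m)| := by
  rcases h with h | h
  · refine le_trans ?_ (le_abs_self _)
    rw [Finset.mul_sum]
    refine Finset.sum_le_sum fun x hx => ?_
    nlinarith [h x hx, hμ x, hf x]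
  · refine le_trans ?_ (neg_le_abs _)
    rw [Finset.mul_sum, ← Finset.sum_neg_distrib]
    refine Finset.sum_le_sum fun x hx => ?_
    nlinarith [h x hx, hμ x, hf x]

section Converse

variable {X Y : Type*} [Fintype X] [Fintype Y] {P : X → ℝ} {W : X → Y → ℝ} {Q : X × Y → ℝ}

/-- Converse bound for a joint distribution under which the information density does not have
mean zero. -/
lemma eventually_le_expectedDist_of_ne (hP : P ∈ stdSimplex ℝ X) (hW : ∀ x, W x ∈ stdSimplex ℝ Y)
    (hQ : Q ∈ stdSimplex ℝ (X × Y)) (hac : ∀ z, jointDist P W z = 0 → Q z = 0)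
    (hκ : ∑ z, Q z * Real.log (W z.1 z.2 / outputDist P W z.2) ≠ 0) {R : ℝ} (hR : 0 ≤ R)
    {ε : ℝ} (hε : 0 < ε) :
    ∀ᶠ n : ℕ in Filter.atTop,
      1 / 16 * Real.exp (-(n * (klSum Q (jointDist P W) +
        1 / 2 * max 0 (R - klSum Q (prodDist P (sndMarginal Q))) + ε))) ≤
      expectedDist P W n ⌈Real.exp (n * R)⌉₊ := by
  classical
  set κ := ∑ z, Q z * Real.log (W z.1 z.2 / outputDist P W z.2) with hκdef
  set d := klSum Q (jointDist P W) with hd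
  set b := klSum Q (prodDist P (sndMarginal Q)) with hb
  set B := max 0 (R - b) with hB
  have hκ0 : 0 < |κ| := abs_pos.2 hκ
  -- The first bound keeps the log-likelihood ratio at distance at least n|κ|/2 from 0 on the
  -- typical set; the second covers the total loss in the exponent, δ from the mass and δ/2 from the
  -- square root.
  obtain ⟨δ, hδ0, hδκ, hδε⟩ : ∃ δ : ℝ, 0 < δ ∧ δ ≤ |κ| / 2 ∧ 3 / 2 * δ ≤ ε :=
    ⟨min (|κ| / 2) (2 / 3 * ε), by positivity, min_le_left _ _, by
      linarith [min_le_right (|κ| / 2) (2 / 3 * ε)]⟩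
  let h : Fin 3 → X × Y → ℝ := ![fun z => Real.log (W z.1 z.2 / outputDist P W z.2),
    fun z => Real.log (Q z / prodDist P (sndMarginal Q) z),
    fun z => Real.log (Q z / jointDist P W z)]
  filter_upwards [eventually_typical hQ h hδ0,
    Filter.eventually_ge_atTop ⌈Real.log 2 / (|κ| / 2)⌉₊] with n hT hn
  have hnκ : Real.log 2 ≤ n * (|κ| / 2) := by
    rw [← div_le_iff₀ (by positivity)]
    exact (Nat.le_ceil _).trans (by exact_mod_cast hn)
  have hM : 0 < ⌈Real.exp (n * R)⌉₊ := Nat.ceil_pos.2 (Real.exp_pos _)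
  have hM2 : (⌈Real.exp (n * R)⌉₊ : ℝ) ≤ 2 * Real.exp (n * R) := by
    have h1 := (Nat.ceil_lt_add_one (Real.exp_pos (n * R)).le).le
    have h2 : 1 ≤ Real.exp (n * R) := Real.one_le_exp (by positivity)
    linarith
  generalize ⌈Real.exp (n * R)⌉₊ = M at hM hM2
  -- Joint typicality for the three log ratios of `h`. Demanding Q ≠ 0 in every coordinate costs no
  -- Q-mass and makes all the logarithms genuine.
  let T : (Fin n → X) → (Fin n → Y) → Prop := fun x y =>
    (∀ k, |∑ i, h k (x i, y i) - n * ∑ a, Q a * h k a| ≤ n * δ) ∧ ∀ i, Q (x i, y i) ≠ 0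
  let A : (Fin n → Y) → Finset (Fin n → X) := fun y => Finset.univ.filter fun x => T x y
  let q : (Fin n → X) → (Fin n → Y) → ℝ := fun x y => ∏ i, Q (x i, y i)
  have hq0 : ∀ x y, 0 ≤ q x y := fun x y => Finset.prod_nonneg fun i _ => hQ.1 _
  have hmass : 1 / 2 ≤ ∑ y, ∑ x ∈ A y, q x y := by
    refine hT.trans (le_of_eq ?_)
    rw [iidMean, ← (Equiv.arrowProdEquivProdArrow (Fin n) (fun _ => X) (fun _ => Y)).symm.sum_comp,
      Fintype.sum_prod_type_right]
    refine Finset.sum_congr rfl fun y _ => ?_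
    rw [Finset.sum_filter]
    refine Finset.sum_congr rfl fun x _ => ?_
    simp only [iidExt, Equiv.arrowProdEquivProdArrow_symm_apply, T, q]
    by_cases hz : ∀ i, Q (x i, y i) ≠ 0
    · simp [hz]
    · push Not at hz
      obtain ⟨i, hi⟩ := hz
      have : ∏ i, Q (x i, y i) = 0 := Finset.prod_eq_zero (Finset.mem_univ i) hi
      simp [this]
  have hPW : ∀ x y, T x y → ∀ i, 0 < P (x i) ∧ 0 < W (x i) (y i) := by
    intro x y hxy i
    have h1 : jointDist P W (x i, y i) ≠ 0 := fun h0 => hxy.2 i (hac _ h0)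
    have h2 := mul_ne_zero_iff.1 h1
    exact ⟨lt_of_le_of_ne (hP.1 _) h2.1.symm, lt_of_le_of_ne ((hW _).1 _) h2.2.symm⟩
  have hQpos : ∀ x y, T x y → ∀ i, 0 < Q (x i, y i) := fun x y hxy i =>
    lt_of_le_of_ne (hQ.1 _) (hxy.2 i).symm
  have hQY : ∀ x y, T x y → ∀ i, 0 < sndMarginal Q (y i) := fun x y hxy i =>
    (hQpos x y hxy i).trans_le (le_sndMarginal hQ.1 (x i, y i))
  have hPY : ∀ x y, T x y → ∀ i, 0 < outputDist P W (y i) := fun x y hxy i =>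
    Finset.sum_pos' (fun x' _ => mul_nonneg (hP.1 x') ((hW _).1 _))
      ⟨x i, Finset.mem_univ _, mul_pos (hPW x y hxy i).1 (hPW x y hxy i).2⟩
  have hWn : ∀ x y, 0 ≤ memorylessExt W n x y := fun x y =>
    Finset.prod_nonneg fun i _ => (hW _).1 _
  -- The sign of κ, not y, decides which alternative holds, so it is the same throughout A y.
  have c0 : ∀ y, (∀ x ∈ A y, 2 * iidExt (outputDist P W) n y ≤ memorylessExt W n x y) ∨
      ∀ x ∈ A y, 2 * memorylessExt W n x y ≤ iidExt (outputDist P W) n y := by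
    intro y
    have hm0 : 0 ≤ iidExt (outputDist P W) n y := iidExt_nonneg (outputDist_mem hP hW).1 n y
    rcases lt_or_gt_of_ne hκ with hneg | hpos
    · right
      intro x hx
      have hx := (Finset.mem_filter.1 hx).2
      have ht := (abs_le.1 (hx.1 0)).2
      change ∑ i, Real.log (W (x i) (y i) / outputDist P W (y i)) - n * κ ≤ n * δ at ht
      have e := prod_eq_mul_exp (fun i => (hPW x y hx i).2) (hPY x y hx)
      change memorylessExt W n x y = iidExt (outputDist P W) n y * _ at e
      rw [abs_of_neg hneg] at hδκ hnκ
      have h3 : Real.exp (∑ i, Real.log (W (x i) (y i) / outputDist P W (y i))) ≤ 1 / 2 := by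
        have h4 : ∑ i, Real.log (W (x i) (y i) / outputDist P W (y i)) ≤ -Real.log 2 := by
          have := mul_le_mul_of_nonneg_left hδκ (Nat.cast_nonneg (α := ℝ) n)
          linarith
        refine (Real.exp_le_exp.2 h4).trans ?_
        rw [Real.exp_neg, Real.exp_log (by norm_num)]
        norm_num
      rw [e]
      nlinarith
    · left
      intro x hx
      have hx := (Finset.mem_filter.1 hx).2
      have ht := (abs_le.1 (hx.1 0)).1
      change -(n * δ) ≤ ∑ i, Real.log (W (x i) (y i) / outputDist P W (y i)) - n * κ at ht
      have e := prod_eq_mul_exp (fun i => (hPW x y hx i).2) (hPY x y hx)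
      change memorylessExt W n x y = iidExt (outputDist P W) n y * _ at e
      rw [abs_of_pos hpos] at hδκ hnκ
      have h3 : 2 ≤ Real.exp (∑ i, Real.log (W (x i) (y i) / outputDist P W (y i))) := by
        have h4 : Real.log 2 ≤ ∑ i, Real.log (W (x i) (y i) / outputDist P W (y i)) := by
          have := mul_le_mul_of_nonneg_left hδκ (Nat.cast_nonneg (α := ℝ) n)
          linarith
        refine le_trans ?_ (Real.exp_le_exp.2 h4)
        rw [Real.exp_log (by norm_num)]
      rw [e]
      nlinarith
  have c1 : ∀ x y, T x y → iidExt P n x * iidExt (sndMarginal Q) n y ≤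
      Real.exp (-(n * (b - δ))) * q x y := by
    intro x y hx
    have ht := (abs_le.1 (hx.1 1)).1
    change -(n * δ) ≤ ∑ i, Real.log (Q (x i, y i) / (P (x i) * sndMarginal Q (y i))) - n * b at ht
    have e := prod_eq_mul_exp (hQpos x y hx) fun i => mul_pos (hPW x y hx i).1 (hQY x y hx i)
    rw [Finset.prod_mul_distrib] at e
    change q x y = iidExt P n x * iidExt (sndMarginal Q) n y * _ at e
    have hnn : 0 ≤ iidExt P n x * iidExt (sndMarginal Q) n y :=
      mul_nonneg (iidExt_nonneg hP.1 n x) (Finset.prod_nonneg fun i _ => (hQY x y hx i).le)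
    rw [e, mul_left_comm, ← Real.exp_add]
    refine le_mul_of_one_le_right hnn (Real.one_le_exp ?_)
    linarith
  have c2 : ∀ x y, T x y → Real.exp (-(n * (d + δ))) * q x y ≤
      iidExt P n x * memorylessExt W n x y := by
    intro x y hx
    have ht := (abs_le.1 (hx.1 2)).2
    change ∑ i, Real.log (Q (x i, y i) / (P (x i) * W (x i) (y i))) - n * d ≤ n * δ at ht
    have e := prod_eq_mul_exp (hQpos x y hx) fun i => mul_pos (hPW x y hx i).1 (hPW x y hx i).2
    rw [Finset.prod_mul_distrib] at e
    change q x y = iidExt P n x * memorylessExt W n x y * _ at e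
    have hnn : 0 ≤ iidExt P n x * memorylessExt W n x y :=
      mul_nonneg (iidExt_nonneg hP.1 n x) (hWn x y)
    rw [e, mul_left_comm, ← Real.exp_add]
    refine mul_le_of_le_one_right hnn (Real.exp_le_one_iff.2 ?_)
    linarith
  -- Change of measure on a section: weighted by Q_Y^n(y), the P_{X^n}-mass of A y is at most
  -- exp(-n(b-δ)) times a sum of Q^n(x,y), which is at most Q_Y^n(y).
  have hp : ∀ y, ∑ x ∈ A y, iidExt P n x ≤ Real.exp (-(n * (b - δ))) := by
    intro y
    rcases (A y).eq_empty_or_nonempty with h0 | ⟨x0, hx0⟩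
    · simp [h0, Real.exp_nonneg]
    · have hx0 := (Finset.mem_filter.1 hx0).2
      have hpos : 0 < iidExt (sndMarginal Q) n y := Finset.prod_pos fun i _ => hQY x0 y hx0 i
      refine le_of_mul_le_mul_right ?_ hpos
      calc (∑ x ∈ A y, iidExt P n x) * iidExt (sndMarginal Q) n y
          ≤ ∑ x ∈ A y, Real.exp (-(n * (b - δ))) * q x y := by
            rw [Finset.sum_mul]
            exact Finset.sum_le_sum fun x hx => c1 x y (Finset.mem_filter.1 hx).2
        _ ≤ ∑ x, Real.exp (-(n * (b - δ))) * q x y :=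
            Finset.sum_le_sum_of_subset_of_nonneg (Finset.subset_univ _)
              fun x _ _ => mul_nonneg (Real.exp_nonneg _) (hq0 x y)
        _ = _ := by
            rw [← Finset.mul_sum, sum_prod_apply fun i x => Q (x, y i)]
            rfl
  -- The 1 under the root is why the positive part B appears: when few codewords are expected in A
  -- y, the denominator is bounded by the constant term instead.
  have hden : ∀ y, √(3 * (M * ∑ x ∈ A y, iidExt P n x) + 1) ≤
      3 * Real.exp (n * ((B + δ) / 2)) := by
    intro y
    refine Real.sqrt_le_iff.2 ⟨by positivity, ?_⟩
    have hB0 : 0 ≤ B := le_max_left _ _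
    have e1 : (M : ℝ) * ∑ x ∈ A y, iidExt P n x ≤ 2 * Real.exp (n * (B + δ)) := by
      calc (M : ℝ) * ∑ x ∈ A y, iidExt P n x
          ≤ (2 * Real.exp (n * R)) * Real.exp (-(n * (b - δ))) :=
            mul_le_mul hM2 (hp y) (Finset.sum_nonneg fun x _ => iidExt_nonneg hP.1 n x)
              (by positivity)
        _ = 2 * Real.exp (n * (R - b + δ)) := by
            rw [mul_assoc, ← Real.exp_add]; congr 2; ring
        _ ≤ _ := by
            have : R - b ≤ B := le_max_right _ _
            gcongr
    have e2 : 1 ≤ Real.exp (n * (B + δ)) := Real.one_le_exp (by positivity)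
    rw [mul_pow, ← Real.exp_nat_mul]
    have e3 : ((2 : ℕ) : ℝ) * (n * ((B + δ) / 2)) = n * (B + δ) := by push_cast; ring
    rw [e3]
    linarith
  have hy : ∀ y, 1 / 8 * Real.exp (-(n * ((B + δ) / 2))) *
      (Real.exp (-(n * (d + δ))) * ∑ x ∈ A y, q x y) ≤
      iidMean (iidExt P n) M (fun c => |1 / (M : ℝ) * ∑ j, memorylessExt W n (c j) y -
        ∑ x, iidExt P n x * memorylessExt W n x y|) := by
    intro y
    refine le_trans ?_ (le_iidMean_abs_average (iidExt_nonneg hP.1 n) (sum_iidExt hP.2 n)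
      (fun x => memorylessExt W n x y) (A y) hM)
    have hmean : ∑ x, iidExt P n x * memorylessExt W n x y = iidExt (outputDist P W) n y :=
      congrFun (outputDist_ext n) y
    rw [hmean, le_div_iff₀ (Real.sqrt_pos.2 (by
      have := Finset.sum_nonneg fun x (_ : x ∈ A y) => iidExt_nonneg hP.1 n x
      positivity))]
    have hJ : Real.exp (-(n * (d + δ))) * ∑ x ∈ A y, q x y ≤
        ∑ x ∈ A y, iidExt P n x * memorylessExt W n x y := by
      rw [Finset.mul_sum]
      exact Finset.sum_le_sum fun x hx => c2 x y (Finset.mem_filter.1 hx).2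
    have hJ0 : 0 ≤ Real.exp (-(n * (d + δ))) * ∑ x ∈ A y, q x y :=
      mul_nonneg (Real.exp_nonneg _) (Finset.sum_nonneg fun x _ => hq0 x y)
    have habs := half_sum_le_abs (iidExt_nonneg hP.1 n) (fun x => hWn x y) (c0 y)
    set J := Real.exp (-(n * (d + δ))) * ∑ x ∈ A y, q x y with hJdef
    calc 1 / 8 * Real.exp (-(n * ((B + δ) / 2))) * J * √(3 * (M * ∑ x ∈ A y, iidExt P n x) + 1)
        ≤ 1 / 8 * Real.exp (-(n * ((B + δ) / 2))) * J * (3 * Real.exp (n * ((B + δ) / 2))) :=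
          mul_le_mul_of_nonneg_left (hden y) (by positivity)
      _ = 3 / 8 * J * (Real.exp (-(n * ((B + δ) / 2))) * Real.exp (n * ((B + δ) / 2))) := by ring
      _ = 3 / 8 * J := by rw [← Real.exp_add, neg_add_cancel, Real.exp_zero, mul_one]
      _ ≤ _ := by linarith
  rw [expectedDist_eq]
  refine le_trans ?_ (Finset.sum_le_sum fun y _ => hy y)
  rw [← Finset.mul_sum, ← Finset.mul_sum]
  calc 1 / 16 * Real.exp (-(n * (d + 1 / 2 * B + ε)))
      ≤ 1 / 16 * Real.exp (-(n * ((B + δ) / 2)) + -(n * (d + δ))) := by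
        have := mul_le_mul_of_nonneg_left hδε (Nat.cast_nonneg (α := ℝ) n)
        gcongr
        linarith
    _ = 1 / 8 * Real.exp (-(n * ((B + δ) / 2))) * (Real.exp (-(n * (d + δ))) * (1 / 2)) := by
        rw [Real.exp_add]; ring
    _ ≤ _ := by gcongr

end Converse

/-! ### Removing the condition on the information density. -/

section GeneralConverse

variable {X Y : Type*} [Fintype X] [Fintype Y] {P : X → ℝ} {W : X → Y → ℝ} {Q : X × Y → ℝ}

lemma mutualInfo_eq_sum :
    mutualInfo P W = ∑ z, jointDist P W z * Real.log (W z.1 z.2 / outputDist P W z.2) := by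
  simp only [mutualInfo, jointDist, Fintype.sum_prod_type]

/-- Termwise log u ≥ 1 - 1/u, whose weighted right-hand sides sum to zero; nondegeneracy makes one
of the inequalities strict. -/
lemma mutualInfo_pos (hP : P ∈ stdSimplex ℝ X) (hW : ∀ x, W x ∈ stdSimplex ℝ Y)
    (hnd : Nondegenerate P W) : 0 < mutualInfo P W := by
  have hO := outputDist_mem hP hW
  have hzero : ∑ z : X × Y, P z.1 * (W z.1 z.2 - outputDist P W z.2) = 0 := by
    rw [Fintype.sum_prod_type]
    simp [← Finset.mul_sum, Finset.sum_sub_distrib, (hW _).2, hO.2]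
  have hOpos : ∀ x y, 0 < P x → 0 < W x y → 0 < outputDist P W y := fun x y hx hy =>
    Finset.sum_pos' (fun x' _ => mul_nonneg (hP.1 x') ((hW _).1 _))
      ⟨x, Finset.mem_univ _, mul_pos hx hy⟩
  have hle : ∀ z : X × Y, P z.1 * (W z.1 z.2 - outputDist P W z.2) ≤
      jointDist P W z * Real.log (W z.1 z.2 / outputDist P W z.2) := by
    rintro ⟨x, y⟩
    simp only [jointDist, mul_assoc]
    rcases (hP.1 x).eq_or_lt with h0 | hx
    · simp [← h0]
    refine mul_le_mul_of_nonneg_left ?_ hx.le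
    rcases ((hW x).1 y).eq_or_lt with h0 | hy
    · simp [← h0, hO.1 y]
    have ho := hOpos x y hx hy
    have h1 := Real.one_sub_inv_le_log_of_pos (div_pos hy ho)
    calc W x y - outputDist P W y = W x y * (1 - (W x y / outputDist P W y)⁻¹) := by
          field_simp
      _ ≤ _ := mul_le_mul_of_nonneg_left h1 hy.le
  rw [mutualInfo_eq_sum, ← hzero]
  obtain ⟨x, hx, hne⟩ := hnd
  obtain ⟨y, hne⟩ := Function.ne_iff.1 hne
  refine Finset.sum_lt_sum (fun z _ => hle z) ⟨(x, y), Finset.mem_univ _, ?_⟩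
  have hx : 0 < P x := lt_of_le_of_ne (hP.1 x) hx.symm
  simp only [jointDist, mul_assoc]
  refine mul_lt_mul_of_pos_left ?_ hx
  rcases ((hW x).1 y).eq_or_lt with h0 | hy
  · rw [← h0] at hne
    simpa [← h0] using lt_of_le_of_ne (hO.1 y) hne
  have ho := hOpos x y hx hy
  have h1 := Real.log_lt_sub_one_of_pos (div_pos ho hy) (by
    rw [ne_eq, div_eq_one_iff_eq hy.ne']; exact hne.symm)
  rw [← inv_div, Real.log_inv]
  calc W x y - outputDist P W y = W x y * -(outputDist P W y / W x y - 1) := by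
        field_simp
        ring
    _ < _ := mul_lt_mul_of_pos_left (neg_lt_neg h1) hy

/-- In this entropy form the moving marginal Q_Y occurs only through s log s, so continuity in Q
survives at points where it vanishes. -/
lemma klSum_prodDist_eq (hQ : ∀ z, 0 ≤ Q z) (hac : ∀ z, P z.1 = 0 → Q z = 0) :
    klSum Q (prodDist P (sndMarginal Q)) = ∑ z, Q z * Real.log (Q z) -
      ∑ z, Q z * Real.log (P z.1) - ∑ y, sndMarginal Q y * Real.log (sndMarginal Q y) := by
  have e : ∑ y, sndMarginal Q y * Real.log (sndMarginal Q y) =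
      ∑ z, Q z * Real.log (sndMarginal Q z.2) := by
    rw [Fintype.sum_prod_type_right]
    exact Finset.sum_congr rfl fun y _ => Finset.sum_mul ..
  rw [e, ← Finset.sum_sub_distrib, ← Finset.sum_sub_distrib, klSum]
  refine Finset.sum_congr rfl fun z _ => ?_
  rcases (hQ z).eq_or_lt with h0 | hz
  · simp [← h0]
  have hp : P z.1 ≠ 0 := fun h => hz.ne' (hac z h)
  have hs : sndMarginal Q z.2 ≠ 0 := (hz.trans_le (le_sndMarginal hQ z)).ne'
  rw [prodDist, Real.log_div hz.ne' (mul_ne_zero hp hs), Real.log_mul hp hs]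
  ring

lemma tendsto_mul_log_div {α : Type*} {l : Filter α} {u : α → ℝ} {a : ℝ}
    (hu : Filter.Tendsto u l (nhds a)) (c : ℝ) :
    Filter.Tendsto (fun t => u t * Real.log (u t / c)) l (nhds (a * Real.log (a / c))) := by
  rcases eq_or_ne c 0 with rfl | hc
  · simpa using tendsto_const_nhds
  have h := ((Real.continuous_mul_log.tendsto (a / c)).comp (hu.div_const c)).const_mul c
  have e : ∀ v, c * (v / c * Real.log (v / c)) = v * Real.log (v / c) := by
    intro v; field_simp
  simpa only [Function.comp_def, e] using h

/-- Converse bound for every joint distribution that is absolutely continuous with respect to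
`P_{XY}`. -/
lemma eventually_le_expectedDist (hP : P ∈ stdSimplex ℝ X) (hW : ∀ x, W x ∈ stdSimplex ℝ Y)
    (hnd : Nondegenerate P W) (hQ : Q ∈ stdSimplex ℝ (X × Y))
    (hac : ∀ z, jointDist P W z = 0 → Q z = 0) {R : ℝ} (hR : 0 ≤ R) {ε : ℝ} (hε : 0 < ε) :
    ∀ᶠ n : ℕ in Filter.atTop,
      1 / 16 * Real.exp (-(n * (klSum Q (jointDist P W) +
        1 / 2 * max 0 (R - klSum Q (prodDist P (sndMarginal Q))) + ε))) ≤
      expectedDist P W n ⌈Real.exp (n * R)⌉₊ := by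
  by_cases hκ : ∑ z, Q z * Real.log (W z.1 z.2 / outputDist P W z.2) = 0
  swap
  · exact eventually_le_expectedDist_of_ne hP hW hQ hac hκ hR hε
  -- Moving towards P_XY makes the mean information density t·I, which is nonzero for t > 0, while
  -- the objective changes by less than ε/2 for small t.
  let q : ℝ → X × Y → ℝ := fun t z => (1 - t) * Q z + t * jointDist P W z
  have hJ := jointDist_mem hP hW
  have hq : ∀ t ∈ Set.Ioo (0 : ℝ) 1, q t ∈ stdSimplex ℝ (X × Y) := by
    intro t ht
    refine ⟨fun z => add_nonneg (mul_nonneg (by linarith [ht.2]) (hQ.1 z))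
      (mul_nonneg ht.1.le (hJ.1 z)), ?_⟩
    simp only [q, Finset.sum_add_distrib, ← Finset.mul_sum, hQ.2, hJ.2]
    ring
  have hqac : ∀ t z, jointDist P W z = 0 → q t z = 0 := fun t z hz => by simp [q, hz, hac z hz]
  have hPac : ∀ p : X × Y → ℝ, (∀ z, jointDist P W z = 0 → p z = 0) → ∀ z, P z.1 = 0 → p z = 0 :=
    fun p hp z hz => hp z (by simp [jointDist, hz])
  have hq0 : q 0 = Q := by funext z; simp [q]
  have ht0 : ∀ z, Filter.Tendsto (fun t => q t z) (nhdsWithin 0 (Set.Ioi 0)) (nhds (Q z)) := by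
    intro z
    have : Continuous fun t => q t z := by fun_prop
    have := this.tendsto 0
    rw [hq0] at this
    exact this.mono_left nhdsWithin_le_nhds
  have hts : ∀ y, Filter.Tendsto (fun t => sndMarginal (q t) y) (nhdsWithin 0 (Set.Ioi 0))
      (nhds (sndMarginal Q y)) := fun y => tendsto_finsetSum _ fun x _ => ht0 (x, y)
  have htd : Filter.Tendsto (fun t => klSum (q t) (jointDist P W)) (nhdsWithin 0 (Set.Ioi 0))
      (nhds (klSum Q (jointDist P W))) :=
    tendsto_finsetSum _ fun z _ => tendsto_mul_log_div (ht0 z) _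
  have hIoo : ∀ᶠ t in nhdsWithin (0 : ℝ) (Set.Ioi 0), t ∈ Set.Ioo (0 : ℝ) 1 :=
    Ioo_mem_nhdsGT one_pos
  have htb : Filter.Tendsto (fun t => klSum (q t) (prodDist P (sndMarginal (q t))))
      (nhdsWithin 0 (Set.Ioi 0)) (nhds (klSum Q (prodDist P (sndMarginal Q)))) := by
    rw [klSum_prodDist_eq hQ.1 (hPac Q hac)]
    have hcomp : ∀ {u : ℝ → ℝ} {a : ℝ}, Filter.Tendsto u (nhdsWithin 0 (Set.Ioi 0)) (nhds a) →
        Filter.Tendsto (fun t => u t * Real.log (u t)) (nhdsWithin 0 (Set.Ioi 0))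
          (nhds (a * Real.log a)) := fun hu => (Real.continuous_mul_log.tendsto _).comp hu
    refine Filter.Tendsto.congr' ?_ (((tendsto_finsetSum _ fun z _ => hcomp (ht0 z)).sub
      (tendsto_finsetSum _ fun z _ => (ht0 z).mul_const (Real.log (P z.1)))).sub
      (tendsto_finsetSum _ fun y _ => hcomp (hts y)))
    filter_upwards [hIoo] with t ht
    exact (klSum_prodDist_eq (hq t ht).1 (hPac _ (hqac t))).symm
  have hobj := htd.add (((tendsto_const_nhds (x := (0 : ℝ))).max (htb.const_sub R)).const_mul (1 / 2))
  obtain ⟨t, htlt, ht⟩ :=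
    ((hobj.eventually_lt_const (lt_add_of_pos_right _ (half_pos hε))).and hIoo).exists
  have hκt : ∑ z, q t z * Real.log (W z.1 z.2 / outputDist P W z.2) ≠ 0 := by
    have : ∑ z, q t z * Real.log (W z.1 z.2 / outputDist P W z.2) = t * mutualInfo P W := by
      simp only [q, add_mul, Finset.sum_add_distrib, mul_assoc, ← Finset.mul_sum, hκ,
        mutualInfo_eq_sum]
      ring
    rw [this]
    exact (mul_pos ht.1 (mutualInfo_pos hP hW hnd)).ne'
  filter_upwards [eventually_le_expectedDist_of_ne hP hW (hq t ht) (hqac t) hκt hR (half_pos hε)]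
    with n hn
  refine le_trans ?_ hn
  refine mul_le_mul_of_nonneg_left (Real.exp_le_exp.2 (neg_le_neg
    (mul_le_mul_of_nonneg_left ?_ n.cast_nonneg))) (by norm_num)
  linarith

end GeneralConverse

/-! ### The tilted law and the equality of primal and dual values. -/

section Optimizer

variable {X Y : Type*} [Fintype X] [Fintype Y] {P : X → ℝ} {W : X → Y → ℝ}

/-- The joint distribution that is optimal in the primal problem when `l` is optimal in the dual
one. -/
def tiltedDist (P : X → ℝ) (W : X → Y → ℝ) (l : ℝ) : X × Y → ℝ := fun z =>
  P z.1 * W z.1 z.2 ^ l * (∑ x, P x * W x z.2 ^ l) ^ (1 / l - 1) / sibsonSum P W l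

lemma sndMarginal_tiltedDist (hP : P ∈ stdSimplex ℝ X) (hW : ∀ x, W x ∈ stdSimplex ℝ Y) {l : ℝ}
    (hl : 0 < l) (y : Y) :
    sndMarginal (tiltedDist P W l) y = (∑ x, P x * W x y ^ l) ^ (1 / l) / sibsonSum P W l := by
  simp only [sndMarginal, tiltedDist, ← Finset.sum_div, ← Finset.sum_mul]
  congr 1
  have hg : 0 ≤ ∑ x, P x * W x y ^ l :=
    Finset.sum_nonneg fun x _ => mul_nonneg (hP.1 x) (Real.rpow_nonneg ((hW x).1 y) l)
  rcases hg.eq_or_lt with h0 | hpos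
  · rw [← h0, Real.zero_rpow (one_div_ne_zero hl.ne'), zero_mul]
  · rw [Real.rpow_sub_one hpos.ne', mul_div_cancel₀ _ hpos.ne']

lemma tiltedDist_mem (hP : P ∈ stdSimplex ℝ X) (hW : ∀ x, W x ∈ stdSimplex ℝ Y) {l : ℝ}
    (hl : 0 < l) : tiltedDist P W l ∈ stdSimplex ℝ (X × Y) := by
  have hZ := sibsonSum_pos hP hW l
  refine ⟨fun z => ?_, ?_⟩
  · have hg : 0 ≤ ∑ x, P x * W x z.2 ^ l :=
      Finset.sum_nonneg fun x _ => mul_nonneg (hP.1 x) (Real.rpow_nonneg ((hW x).1 _) l)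
    exact div_nonneg (mul_nonneg (mul_nonneg (hP.1 _) (Real.rpow_nonneg ((hW _).1 _) _))
      (Real.rpow_nonneg hg _)) hZ.le
  · rw [Fintype.sum_prod_type_right]
    have : ∀ y, ∑ x, tiltedDist P W l (x, y) = _ := sndMarginal_tiltedDist hP hW hl
    simp only [this, ← Finset.sum_div]
    exact div_self hZ.ne'

lemma tiltedDist_ac {l : ℝ} (hl : 0 < l) (z : X × Y) (hz : jointDist P W z = 0) :
    tiltedDist P W l z = 0 := by
  rcases mul_eq_zero.1 hz with h | h
  · simp [tiltedDist, h]
  · simp [tiltedDist, h, Real.zero_rpow hl.ne']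

lemma pos_of_tiltedDist_ne_zero (hP : P ∈ stdSimplex ℝ X) (hW : ∀ x, W x ∈ stdSimplex ℝ Y) {l : ℝ}
    (hl : 0 < l) {z : X × Y} (hz : tiltedDist P W l z ≠ 0) :
    0 < P z.1 ∧ 0 < W z.1 z.2 ∧ 0 < ∑ x, P x * W x z.2 ^ l := by
  have h := mul_ne_zero_iff.1 (mt (tiltedDist_ac hl z) hz)
  have h1 : 0 < P z.1 := lt_of_le_of_ne (hP.1 _) h.1.symm
  have h2 : 0 < W z.1 z.2 := lt_of_le_of_ne ((hW _).1 _) h.2.symm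
  exact ⟨h1, h2, Finset.sum_pos'
    (fun x _ => mul_nonneg (hP.1 x) (Real.rpow_nonneg ((hW x).1 _) l))
    ⟨z.1, Finset.mem_univ _, mul_pos h1 (Real.rpow_pos_of_pos h2 l)⟩⟩

lemma klSum_tiltedDist_prodDist (hP : P ∈ stdSimplex ℝ X) (hW : ∀ x, W x ∈ stdSimplex ℝ Y) {l : ℝ}
    (hl : 0 < l) :
    klSum (tiltedDist P W l) (prodDist P (sndMarginal (tiltedDist P W l))) =
      ∑ z, tiltedDist P W l z *
        (l * Real.log (W z.1 z.2) - Real.log (∑ x, P x * W x z.2 ^ l)) := by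
  have hZ := sibsonSum_pos hP hW l
  refine Finset.sum_congr rfl fun z _ => ?_
  by_cases hz : tiltedDist P W l z = 0
  · simp [hz]
  obtain ⟨h1, h2, h3⟩ := pos_of_tiltedDist_ne_zero hP hW hl hz
  congr 1
  rw [← Real.log_rpow h2, ← Real.log_div (Real.rpow_pos_of_pos h2 l).ne' h3.ne', prodDist,
    sndMarginal_tiltedDist hP hW hl, tiltedDist, Real.rpow_sub_one h3.ne']
  congr 1
  have := Real.rpow_pos_of_pos h3 (1 / l)
  field_simp

/-- Both log ratios are affine in log W and in the logarithm of the inner sum, with proportional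
coefficients. This affine relation is what makes the primal value at the tilted law computable. -/
lemma klSum_tiltedDist_jointDist (hP : P ∈ stdSimplex ℝ X) (hW : ∀ x, W x ∈ stdSimplex ℝ Y) {l : ℝ}
    (hl : 0 < l) :
    klSum (tiltedDist P W l) (jointDist P W) =
      (l - 1) / l * klSum (tiltedDist P W l) (prodDist P (sndMarginal (tiltedDist P W l))) -
        Real.log (sibsonSum P W l) := by
  have hZ := sibsonSum_pos hP hW l
  have e : Real.log (sibsonSum P W l) =
      ∑ z, tiltedDist P W l z * Real.log (sibsonSum P W l) := by
    rw [← Finset.sum_mul, (tiltedDist_mem hP hW hl).2, one_mul]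
  rw [klSum_tiltedDist_prodDist hP hW hl, e, Finset.mul_sum, ← Finset.sum_sub_distrib]
  refine Finset.sum_congr rfl fun z _ => ?_
  by_cases hz : tiltedDist P W l z = 0
  · simp [hz]
  obtain ⟨h1, h2, h3⟩ := pos_of_tiltedDist_ne_zero hP hW hl hz
  have hl' := (Real.rpow_pos_of_pos h2 l).ne'
  have h3' := (Real.rpow_pos_of_pos h3 (1 / l - 1)).ne'
  have : Real.log (tiltedDist P W l z / jointDist P W z) = l * Real.log (W z.1 z.2) +
      (1 / l - 1) * Real.log (∑ x, P x * W x z.2 ^ l) - Real.log (sibsonSum P W l) -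
      Real.log (W z.1 z.2) := by
    rw [← Real.log_rpow h2, ← Real.log_rpow h3, ← Real.log_mul hl' h3',
      ← Real.log_div (mul_ne_zero hl' h3') hZ.ne', ← Real.log_div
        (div_ne_zero (mul_ne_zero hl' h3') hZ.ne') h2.ne', tiltedDist, jointDist]
    congr 1
    field_simp
  rw [this]
  field_simp
  ring

lemma hasDerivAt_const_rpow_of_pos {c l : ℝ} (hc : 0 ≤ c) (hl : 0 < l) :
    HasDerivAt (fun t : ℝ => c ^ t) (c ^ l * Real.log c) l := by
  rcases hc.eq_or_lt with rfl | hc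
  · rw [Real.log_zero, mul_zero]
    refine (hasDerivAt_const l (0 : ℝ)).congr_of_eventuallyEq ?_
    filter_upwards [lt_mem_nhds hl] with t ht
    exact Real.zero_rpow (ne_of_gt ht)
  · simpa [mul_comm] using (hasDerivAt_id l).const_rpow hc

/-- Logarithmic differentiation of each output term reproduces the tilted weights. An output whose
inner sum vanishes does so for every positive order, so its term is locally the constant 0. -/
lemma hasDerivAt_sibsonSum (hP : P ∈ stdSimplex ℝ X) (hW : ∀ x, W x ∈ stdSimplex ℝ Y) {l : ℝ}
    (hl : 0 < l) :
    HasDerivAt (sibsonSum P W) (sibsonSum P W l *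
      klSum (tiltedDist P W l) (prodDist P (sndMarginal (tiltedDist P W l))) / l ^ 2) l := by
  have hZ := sibsonSum_pos hP hW l
  have hg : ∀ y, HasDerivAt (fun t => ∑ x, P x * W x y ^ t)
      (∑ x, P x * (W x y ^ l * Real.log (W x y))) l := fun y =>
    HasDerivAt.fun_sum fun x _ => (hasDerivAt_const_rpow_of_pos ((hW x).1 y) hl).const_mul (P x)
  have hy : ∀ y, HasDerivAt (fun t => (∑ x, P x * W x y ^ t) ^ (1 / t))
      (∑ x, sibsonSum P W l * (tiltedDist P W l (x, y) *
        (l * Real.log (W x y) - Real.log (∑ x, P x * W x y ^ l))) / l ^ 2) l := by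
    intro y
    have hnn : 0 ≤ ∑ x, P x * W x y ^ l :=
      Finset.sum_nonneg fun x _ => mul_nonneg (hP.1 x) (Real.rpow_nonneg ((hW x).1 y) l)
    rcases hnn.eq_or_lt with h0 | hpos
    · have hx : ∀ x, P x = 0 ∨ W x y = 0 := by
        intro x
        have := (Finset.sum_eq_zero_iff_of_nonneg (fun x _ =>
          mul_nonneg (hP.1 x) (Real.rpow_nonneg ((hW x).1 y) l))).1 h0.symm x (Finset.mem_univ x)
        exact (mul_eq_zero.1 this).imp_right fun h => (Real.rpow_eq_zero ((hW x).1 y) hl.ne').1 h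
      have hq : ∀ x, tiltedDist P W l (x, y) = 0 := fun x =>
        tiltedDist_ac hl _ (mul_eq_zero.2 (hx x))
      simp only [hq, zero_mul, mul_zero, zero_div, Finset.sum_const_zero]
      refine (hasDerivAt_const l (0 : ℝ)).congr_of_eventuallyEq ?_
      filter_upwards [lt_mem_nhds hl] with t ht
      have ht : t ≠ 0 := ne_of_gt ht
      have : ∑ x, P x * W x y ^ t = 0 := Finset.sum_eq_zero fun x _ => by
        rcases hx x with h | h <;> simp [h, Real.zero_rpow ht]
      rw [this, Real.zero_rpow (one_div_ne_zero ht)]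
    · have hinv : HasDerivAt (fun t : ℝ => 1 / t) (-(1 / l ^ 2)) l := by
        simpa using hasDerivAt_inv hl.ne'
      convert (hg y).rpow hinv hpos using 1
      set g := ∑ x, P x * W x y ^ l with hgdef
      have e1 : g ^ (1 / l) = g ^ (1 / l - 1) * g := by
        rw [Real.rpow_sub_one hpos.ne', div_mul_cancel₀ _ hpos.ne']
      have e2 : ∀ x, sibsonSum P W l * (tiltedDist P W l (x, y) *
          (l * Real.log (W x y) - Real.log g)) / l ^ 2 =
          1 / l * g ^ (1 / l - 1) * (P x * (W x y ^ l * Real.log (W x y))) -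
          1 / l ^ 2 * g ^ (1 / l - 1) * Real.log g * (P x * W x y ^ l) := by
        intro x
        rw [tiltedDist]
        simp only [← hgdef]
        field_simp
      simp only [e2, Finset.sum_sub_distrib, ← Finset.mul_sum, ← hgdef]
      rw [e1]
      ring
  refine (HasDerivAt.fun_sum (fun y (_ : y ∈ Finset.univ) => hy y)).congr_deriv ?_
  rw [klSum_tiltedDist_prodDist hP hW hl, Fintype.sum_prod_type_right]
  simp only [← Finset.sum_div, ← Finset.mul_sum]

lemma hasDerivAt_dual (hP : P ∈ stdSimplex ℝ X) (hW : ∀ x, W x ∈ stdSimplex ℝ Y) (R : ℝ) {l : ℝ}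
    (hl : 0 < l) :
    HasDerivAt (fun t => (t - 1) / t * R - Real.log (sibsonSum P W t))
      ((R - klSum (tiltedDist P W l) (prodDist P (sndMarginal (tiltedDist P W l)))) / l ^ 2)
      l := by
  have hZ := sibsonSum_pos hP hW l
  have h1 := (((hasDerivAt_id l).sub_const 1).div (hasDerivAt_id l) hl.ne').mul_const R
  refine (h1.sub ((hasDerivAt_sibsonSum hP hW hl).log hZ.ne')).congr_deriv ?_
  simp only [id]
  field_simp
  ring

lemma sibsonSum_one (hP : P ∈ stdSimplex ℝ X) (hW : ∀ x, W x ∈ stdSimplex ℝ Y) :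
    sibsonSum P W 1 = 1 := by
  refine Eq.trans ?_ (outputDist_mem hP hW).2
  simp [sibsonSum, outputDist]

lemma klSum_tiltedDist_one (hP : P ∈ stdSimplex ℝ X) (hW : ∀ x, W x ∈ stdSimplex ℝ Y) :
    klSum (tiltedDist P W 1) (prodDist P (sndMarginal (tiltedDist P W 1))) = mutualInfo P W := by
  rw [klSum_tiltedDist_prodDist hP hW one_pos, mutualInfo_eq_sum]
  have hq : tiltedDist P W 1 = jointDist P W := by
    funext z
    simp [tiltedDist, jointDist, sibsonSum_one hP hW]
  refine Finset.sum_congr rfl fun z _ => ?_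
  by_cases hz : tiltedDist P W 1 z = 0
  · rw [← hq]; simp [hz]
  obtain ⟨h1, h2, h3⟩ := pos_of_tiltedDist_ne_zero hP hW one_pos hz
  simp only [Real.rpow_one] at h3
  rw [hq, outputDist, Real.log_div h2.ne' h3.ne']
  simp

/-- A maximizer of the dual problem, with the equality of the primal and the dual value. -/
lemma exists_dual_maximizer (hP : P ∈ stdSimplex ℝ X) (hW : ∀ x, W x ∈ stdSimplex ℝ Y) {R : ℝ}
    (hR : mutualInfo P W < R) :
    ∃ l ∈ Set.Icc (1 : ℝ) 2,
      IsMaxOn (fun t => (t - 1) / t * R - Real.log (sibsonSum P W t)) (Set.Icc 1 2) l ∧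
      klSum (tiltedDist P W l) (jointDist P W) + 1 / 2 * max 0
        (R - klSum (tiltedDist P W l) (prodDist P (sndMarginal (tiltedDist P W l)))) =
        (l - 1) / l * R - Real.log (sibsonSum P W l) := by
  have hcont : ContinuousOn (fun t => (t - 1) / t * R - Real.log (sibsonSum P W t))
      (Set.Icc 1 2) := fun t ht =>
    (hasDerivAt_dual hP hW R (by linarith [ht.1])).continuousAt.continuousWithinAt
  obtain ⟨l, hl, hmax⟩ := isCompact_Icc.exists_isMaxOn ⟨1, by norm_num⟩ hcont
  refine ⟨l, hl, hmax, ?_⟩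
  have hl0 : 0 < l := by linarith [hl.1]
  have hder := hasDerivAt_dual hP hW R hl0
  -- First-order condition for a maximum on an interval, endpoints included; the positive factor
  -- 1/l² in the derivative is cleared.
  have hvar : ∀ a ∈ Set.Icc (1 : ℝ) 2, (a - l) *
      (R - klSum (tiltedDist P W l) (prodDist P (sndMarginal (tiltedDist P W l)))) ≤ 0 := by
    intro a ha
    have h := hmax.localize.hasFDerivWithinAt_nonpos hder.hasFDerivAt.hasFDerivWithinAt
      (sub_mem_posTangentConeAt_of_segment_subset ((convex_Icc 1 2).segment_subset hl ha))
    simp only [ContinuousLinearMap.toSpanSingleton_apply, smul_eq_mul, ← mul_div_assoc] at h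
    rw [div_le_iff₀ (by positivity)] at h
    linarith
  rw [klSum_tiltedDist_jointDist hP hW hl0]
  -- At order 1 the divergence is I, so the derivative R - I > 0 rules out this endpoint.
  have hne : l ≠ 1 := by
    rintro rfl
    have := hvar 2 (by norm_num)
    rw [klSum_tiltedDist_one hP hW] at this
    linarith
  set b := klSum (tiltedDist P W l) (prodDist P (sndMarginal (tiltedDist P W l)))
  have hl1 : 1 < l := lt_of_le_of_ne hl.1 hne.symm
  have hge : 0 ≤ R - b := by
    have := hvar 1 (by norm_num)
    nlinarith
  -- At l = 2 the weight (l-1)/l equals the 1/2 in front of the positive part; at an interior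
  -- maximizer the divergence equals R and the positive part vanishes.
  rcases hl.2.eq_or_lt with rfl | hl2
  · rw [max_eq_right hge]
    ring
  · have : R - b = 0 := le_antisymm (by have := hvar 2 (by norm_num); nlinarith) hge
    rw [this, max_self, show b = R by linarith]
    ring

end Optimizer

/-! ### Evaluating the objectives, positivity, and exponential rates. -/

section Values

variable {X Y : Type*} [Fintype X] [Fintype Y] {P : X → ℝ} {W : X → Y → ℝ} {Q : X × Y → ℝ}

lemma dualObjective_eq (hP : P ∈ stdSimplex ℝ X) (hW : ∀ x, W x ∈ stdSimplex ℝ Y) (R : ℝ) {l : ℝ}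
    (hl : 0 < l) :
    dualObjective P W R l = (l - 1) / l * R - Real.log (sibsonSum P W l) := by
  rw [dualObjective, sibsonInfo]
  split_ifs with h
  · simp [h, sibsonSum_one hP hW]
  · have : l - 1 ≠ 0 := sub_ne_zero.2 h
    rw [sibsonSum]
    field_simp

lemma primalObjective_eq (hQ : Q ∈ stdSimplex ℝ (X × Y))
    (hac : ∀ z, jointDist P W z = 0 → Q z = 0) (R : ℝ) :
    primalObjective P W R Q = ((klSum Q (jointDist P W) +
      1 / 2 * max 0 (R - klSum Q (prodDist P (sndMarginal Q))) : ℝ) : EReal) := by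
  have hac' : ∀ z, prodDist P (sndMarginal Q) z = 0 → Q z = 0 := by
    intro z hz
    rcases mul_eq_zero.1 hz with h | h
    · exact hac z (by simp [jointDist, h])
    · exact le_antisymm (h ▸ le_sndMarginal hQ.1 z) (hQ.1 z)
  rw [primalObjective, relEntropy, relEntropy, if_pos hac, if_pos hac']
  rw [EReal.coe_add, EReal.coe_mul, EReal.coe_strictMono.monotone.map_max, EReal.coe_sub,
    EReal.coe_zero]
  rfl

lemma primalObjective_eq_top (hac : ¬ ∀ z, jointDist P W z = 0 → Q z = 0) (R : ℝ) :
    primalObjective P W R Q = ⊤ := by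
  rw [primalObjective, relEntropy, if_neg hac]
  refine EReal.top_add_of_ne_bot (ne_of_gt (lt_of_lt_of_le EReal.bot_lt_zero ?_))
  exact mul_nonneg (by exact_mod_cast (by norm_num : (0 : ℝ) ≤ 1 / 2)) (le_max_left _ _)

lemma iidExt_injective {A : Type*} [Fintype A] {p q : A → ℝ} (hp : ∑ a, p a = 1)
    (hq : ∑ a, q a = 1) {n : ℕ} (hn : n ≠ 0) (h : iidExt p n = iidExt q n) : p = q := by
  obtain ⟨k, rfl⟩ := Nat.exists_eq_succ_of_ne_zero hn
  funext a
  have key : ∀ r : A → ℝ, ∑ a, r a = 1 →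
      ∑ y : Fin k → A, iidExt r (k + 1) (Fin.cons a y) = r a := by
    intro r hr
    have : ∀ y : Fin k → A, iidExt r (k + 1) (Fin.cons a y) = r a * iidExt r k y := fun y => by
      simp [iidExt, Fin.prod_univ_succ]
    simp only [this, ← Finset.mul_sum, sum_iidExt hr, mul_one]
  rw [← key p hp, ← key q hq]
  exact Finset.sum_congr rfl fun y _ => congrFun h _

/-- One codebook suffices: all codewords equal to the constant word in a letter x with W x ≠ P_Y. It
induces the i.i.d. law of W x, which differs from that of P_Y. -/
lemma expectedDist_pos (hP : P ∈ stdSimplex ℝ X) (hW : ∀ x, W x ∈ stdSimplex ℝ Y)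
    (hnd : Nondegenerate P W) {n M : ℕ} (hn : n ≠ 0) (hM : 0 < M) : 0 < expectedDist P W n M := by
  obtain ⟨x, hx, hne⟩ := hnd
  have hx : 0 < P x := lt_of_le_of_ne (hP.1 x) hx.symm
  have hM' : (0 : ℝ) < M := by exact_mod_cast hM
  have hl1 : ∀ p q : (Fin n → Y) → ℝ, 0 ≤ l1Dist p q := fun p q =>
    Finset.sum_nonneg fun _ _ => abs_nonneg _
  refine Finset.sum_pos' (fun c _ => mul_nonneg (Finset.prod_nonneg fun j _ =>
    iidExt_nonneg hP.1 n _) (hl1 _ _)) ⟨fun _ _ => x, Finset.mem_univ _, mul_pos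
    (Finset.prod_pos fun _ _ => Finset.prod_pos fun _ _ => hx) ?_⟩
  refine lt_of_le_of_ne (hl1 _ _) fun h0 => hne ?_
  refine iidExt_injective (hW x).2 (outputDist_mem hP hW).2 hn ?_
  rw [← outputDist_ext]
  funext y
  have h1 := (Finset.sum_eq_zero_iff_of_nonneg fun _ _ => abs_nonneg _).1 h0.symm y
    (Finset.mem_univ y)
  have h2 := sub_eq_zero.1 (abs_eq_zero.1 h1)
  rw [← h2, inducedDist]
  simp only [memorylessExt, iidExt, Finset.sum_const, Finset.card_univ, Fintype.card_fin,
    nsmul_eq_mul]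
  field_simp

/-- If `exp (-n u)` is eventually at most a constant times `exp (-n v)`, then `v ≤ u`. -/
lemma le_of_eventually_exp_le {u v c C : ℝ} (hc : 0 < c) (hC : 0 < C)
    (h : ∀ᶠ n : ℕ in Filter.atTop, c * Real.exp (-(n * u)) ≤ C * Real.exp (-(n * v))) :
    v ≤ u := by
  by_contra! huv
  have ht : Filter.Tendsto (fun n : ℕ => (n : ℝ) * (v - u)) Filter.atTop Filter.atTop :=
    tendsto_natCast_atTop_atTop.atTop_mul_const (sub_pos.2 huv)
  obtain ⟨n, hn, hn'⟩ := (h.and (ht.eventually_gt_atTop (Real.log (C / c)))).exists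
  rw [Real.log_lt_iff_lt_exp (by positivity), div_lt_iff₀ hc] at hn'
  have e : Real.exp (-(n * u)) = Real.exp (n * (v - u)) * Real.exp (-(n * v)) := by
    rw [← Real.exp_add]; congr 1; ring
  rw [e] at hn
  nlinarith [Real.exp_pos (-(n * v))]

/-- The exponential rate of a sequence that is squeezed between exponentials. -/
lemma tendsto_neg_log_div {E : ℕ → ℝ} {a c C : ℝ} (hc : 0 < c) (hC : 0 < C)
    (hlow : ∀ ε > 0, ∀ᶠ n : ℕ in Filter.atTop, c * Real.exp (-(n * (a + ε))) ≤ E n)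
    (hup : ∀ n, E n ≤ C * Real.exp (-(n * a))) :
    Filter.Tendsto (fun n : ℕ => -(1 / (n : ℝ)) * Real.log (E n)) Filter.atTop (nhds a) := by
  have hlim : ∀ K : ℝ, Filter.Tendsto (fun n : ℕ => K / (n : ℝ)) Filter.atTop (nhds 0) :=
    fun K => tendsto_const_div_atTop_nhds_zero_nat K
  rw [Metric.tendsto_nhds]
  intro ε hε
  filter_upwards [hlow (ε / 2) (half_pos hε), Filter.eventually_gt_atTop 0,
    (hlim (Real.log C)).eventually_lt_const hε,
    (hlim (Real.log c)).eventually_const_lt (neg_lt_zero.2 (half_pos hε))] with n h1 hn h2 h3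
  have hn' : (0 : ℝ) < n := by exact_mod_cast hn
  have hE : 0 < E n := lt_of_lt_of_le (by positivity) h1
  have l1 := Real.log_le_log (by positivity) h1
  have l2 := Real.log_le_log hE (hup n)
  rw [Real.log_mul hc.ne' (Real.exp_pos _).ne', Real.log_exp] at l1
  rw [Real.log_mul hC.ne' (Real.exp_pos _).ne', Real.log_exp] at l2
  rw [div_lt_iff₀ hn'] at h2
  rw [lt_div_iff₀ hn'] at h3
  have e : -(1 / (n : ℝ)) * Real.log (E n) = -Real.log (E n) / n := by ring
  rw [Real.dist_eq, e, abs_lt]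
  constructor
  · rw [lt_sub_iff_add_lt, lt_div_iff₀ hn']
    linarith
  · rw [sub_lt_iff_lt_add, div_lt_iff₀ hn']
    linarith

end Values

end SoftCovering

end

theorem theorem1 {X Y : Type*} [Fintype X] [Fintype Y] (P : X → ℝ) (W : X → Y → ℝ)
    (hP : P ∈ stdSimplex ℝ X) (hW : ∀ x, W x ∈ stdSimplex ℝ Y)
    (hnd : SoftCovering.Nondegenerate P W) (R : ℝ) (hR : SoftCovering.mutualInfo P W < R) :
    (∀ n : ℕ, 1 ≤ n → 0 < SoftCovering.expectedDist P W n ⌈Real.exp ((n : ℝ) * R)⌉₊) ∧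
    ∃ a : ℝ,
      Filter.Tendsto
        (fun n : ℕ => -(1 / (n : ℝ)) *
          Real.log (SoftCovering.expectedDist P W n ⌈Real.exp ((n : ℝ) * R)⌉₊))
        Filter.atTop (nhds a) ∧
      IsLeast (SoftCovering.primalObjective P W R '' stdSimplex ℝ (X × Y)) (a : EReal) ∧
      IsGreatest (SoftCovering.dualObjective P W R '' Set.Icc 1 2) a := by
  have hR0 : 0 ≤ R := ((SoftCovering.mutualInfo_pos hP hW hnd).trans hR).le
  refine ⟨fun n hn => SoftCovering.expectedDist_pos hP hW hnd (by omega) (Nat.ceil_pos.2 (Real.exp_pos _)), ?_⟩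
  obtain ⟨l, hl, hmax, hval⟩ := SoftCovering.exists_dual_maximizer hP hW hR
  have hl0 : 0 < l := by linarith [hl.1]
  have hup := SoftCovering.expectedDist_le hP hW hl.1 hl.2 R
  have hQ := SoftCovering.tiltedDist_mem hP hW hl0
  refine ⟨(l - 1) / l * R - Real.log (SoftCovering.sibsonSum P W l), ?_, ⟨?_, ?_⟩, ?_, ?_⟩
  · refine SoftCovering.tendsto_neg_log_div (c := 1 / 16) (C := 3) (by norm_num) (by norm_num) ?_ hup
    intro ε hε
    have := SoftCovering.eventually_le_expectedDist hP hW hnd hQ (SoftCovering.tiltedDist_ac hl0) hR0 hε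
    rwa [hval] at this
  · exact ⟨_, hQ, by rw [SoftCovering.primalObjective_eq hQ (SoftCovering.tiltedDist_ac hl0), hval]⟩
  · rintro _ ⟨Q, hQ, rfl⟩
    -- Weak duality is read off operationally: the converse exponent of any such Q cannot be smaller
    -- than the achievable exponent at l.
    by_cases hac : ∀ z, SoftCovering.jointDist P W z = 0 → Q z = 0
    · rw [SoftCovering.primalObjective_eq hQ hac, EReal.coe_le_coe_iff]
      refine le_of_forall_pos_le_add fun ε hε => ?_
      refine SoftCovering.le_of_eventually_exp_le (c := 1 / 16) (C := 3) (by norm_num) (by norm_num) ?_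
      filter_upwards [SoftCovering.eventually_le_expectedDist hP hW hnd hQ hac hR0 hε] with n hn
      exact hn.trans (hup n)
    · rw [SoftCovering.primalObjective_eq_top hac]
      exact le_top
  · exact ⟨l, hl, SoftCovering.dualObjective_eq hP hW R hl0⟩
  · rintro _ ⟨t, ht, rfl⟩
    rw [SoftCovering.dualObjective_eq hP hW R (by linarith [ht.1])]
    exact hmax ht
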